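/- Let $k$ be a field and let $A$ be a Hopf algebra over $k$ with comultiplication $\Delta$, counit $\varepsilon$ and antipode $S$. Assume that $A$ is cosemisimple (every right $A$-comodule is semisimple) and of Kac type ($S^2=\mathrm{id}_A$). Then $$\mathrm{cd}(A)=\mathrm{cd}_{\rm GS}(A)\quad\text{in } \mathbb N\cup\{\infty\},$$ where: * $\mathrm{cd}(A)=\sup\{n : H^n(A,M)\neq 0 \text{ for some } A\text{-bimodule } M\}$ is the Hochschild cohomological dimension of $A$, $H^*(A,M)$ being the Hochschild cohomology of the $k$-algebra $A$ with coefficients in $M$; * $\mathrm{cd}_{\rm GS}(A)=\sup\{n : H^n_{\rm GS}(A,V)\neq 0 \text{ for some Yetter-Drinfeld module } V \text{ over } A\}$ is the Gerstenhaber-Schack cohomological dimension of $A$, with $H^n_{\rm GS}(A,V)=\mathrm{Ext}^n_{\mathcal{YD}_A^A}(k,V)$. Here $\mathcal{YD}_A^A$ is the abelian category of right-right Yetter-Drinfeld modules over $A$, that is, right $A$-modules and right $A$-comodules $V$ such that $$(v\leftarrow a)_{(0)}\otimes (v\leftarrow a)_{(1)} = v_{(0)}\leftarrow a_{(2)}\otimes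 S(a_{(1)})v_{(1)}a_{(3)}\qquad (v\in V,\ a\in A),$$ with the $A$-linear and $A$-colinear maps as morphisms, and $k$ is the trivial Yetter-Drinfeld module (action through $\varepsilon$, coaction $c\mapsto c\otimes 1$). -/

import Mathlib

open CategoryTheory TensorProduct

universe u

noncomputable section

/-! ## Hochschild cohomology -/

namespace Hochschild

variable {k A M : Type u} [Field k] [Ring A] [Algebra k A]
  [AddCommGroup M] [Module k M] [Module A M] [Module Aᵐᵒᵖ M] [SMulCommClass A Aᵐᵒᵖ M]
  [IsScalarTower k A M] [IsScalarTower k Aᵐᵒᵖ M]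

/-- Hochschild `n`-cochains: `k`-multilinear maps `A × ⋯ × A → M` (`n` factors), that is,
linear maps `A ⊗ ⋯ ⊗ A → M`. -/
abbrev Cochain (k A M : Type u) [Field k] [Ring A] [Algebra k A]
    [AddCommGroup M] [Module k M] (n : ℕ) : Type u :=
  MultilinearMap k (fun _ : Fin n => A) M

/-- Merging two neighbouring entries of a family turns updates into updates. -/
theorem contractNth_update {n : ℕ} (j : Fin n) (a : Fin (n + 1) → A) (i : Fin (n + 1)) :
    ∃ (p : Fin n) (L : A →ₗ[k] A), ∀ x : A,
      Fin.contractNth j.castSucc (· * ·) (Function.update a i x) =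
        Function.update (Fin.contractNth j.castSucc (· * ·) a) p (L x) := by
  have hj := j.isLt
  rcases lt_trichotomy (i : ℕ) (j : ℕ) with h | h | h
  · refine ⟨⟨i, by omega⟩, LinearMap.id, fun x => ?_⟩
    funext l
    have hl := l.isLt
    simp only [Fin.contractNth, Function.update_apply, Fin.ext_iff, Fin.val_castSucc,
      Fin.val_succ, LinearMap.id_apply]
    split_ifs <;> first | rfl | omega
  · refine ⟨⟨i, by omega⟩, LinearMap.mulRight k (a j.succ), fun x => ?_⟩
    funext l
    have hl := l.isLt
    simp only [Fin.contractNth, Function.update_apply, Fin.ext_iff, Fin.val_castSucc,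
      Fin.val_succ, LinearMap.mulRight_apply]
    split_ifs with h1 h2 h3 h4 <;> first | rfl | omega | skip
    have : l = j := Fin.ext (by omega)
    rw [this]
  · by_cases h' : (i : ℕ) = j + 1
    · refine ⟨⟨j, by omega⟩, LinearMap.mulLeft k (a j.castSucc), fun x => ?_⟩
      funext l
      have hl := l.isLt
      simp only [Fin.contractNth, Function.update_apply, Fin.ext_iff, Fin.val_castSucc,
        Fin.val_succ, LinearMap.mulLeft_apply]
      split_ifs with h1 h2 h3 h4 <;> first | rfl | omega | skip
      have : l = j := Fin.ext (by omega)
      rw [this]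
    · refine ⟨⟨i - 1, by omega⟩, LinearMap.id, fun x => ?_⟩
      funext l
      have hl := l.isLt
      simp only [Fin.contractNth, Function.update_apply, Fin.ext_iff, Fin.val_castSucc,
        Fin.val_succ, LinearMap.id_apply]
      split_ifs <;> first | rfl | omega

/-- `(a₀, …, aₙ) ↦ a₀ · f(a₁, …, aₙ)`. -/
def firstFace {n : ℕ} (f : Cochain k A M n) : Cochain k A M (n + 1) where
  toFun a := a 0 • f (Fin.tail a)
  map_update_add' := by
    intro hd a i x y
    obtain rfl : hd = instDecidableEqFin _ := Subsingleton.elim _ _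
    refine Fin.cases ?_ (fun i => ?_) i
    · simp [Fin.tail_update_zero, add_smul]
    · have h (z : A) : Function.update a i.succ z 0 = a 0 :=
        Function.update_of_ne (Fin.succ_ne_zero i).symm _ _
      simp only [Fin.tail_update_succ, MultilinearMap.map_update_add, smul_add]
      rw [h, h, h]
  map_update_smul' := by
    intro hd a i c x
    obtain rfl : hd = instDecidableEqFin _ := Subsingleton.elim _ _
    refine Fin.cases ?_ (fun i => ?_) i
    · simp [Fin.tail_update_zero]
    · have h (z : A) : Function.update a i.succ z 0 = a 0 :=
        Function.update_of_ne (Fin.succ_ne_zero i).symm _ _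
      simp only [Fin.tail_update_succ, MultilinearMap.map_update_smul, smul_comm _ c]
      rw [h, h]

/-- `(a₀, …, aₙ) ↦ f(a₀, …, aⱼ aⱼ₊₁, …, aₙ)`. -/
def innerFace {n : ℕ} (j : Fin n) (f : Cochain k A M n) : Cochain k A M (n + 1) where
  toFun a := f (Fin.contractNth j.castSucc (· * ·) a)
  map_update_add' := by
    intro hd a i x y
    rw [Subsingleton.elim hd (instDecidableEqFin _)]
    obtain ⟨p, L, h⟩ := contractNth_update (k := k) j a i
    simp only [h, map_add, MultilinearMap.map_update_add]
  map_update_smul' := by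
    intro hd a i c x
    rw [Subsingleton.elim hd (instDecidableEqFin _)]
    obtain ⟨p, L, h⟩ := contractNth_update (k := k) j a i
    simp only [h, map_smul, MultilinearMap.map_update_smul]

/-- `(a₀, …, aₙ) ↦ f(a₀, …, aₙ₋₁) · aₙ`. -/
def lastFace {n : ℕ} (f : Cochain k A M n) : Cochain k A M (n + 1) where
  toFun a := MulOpposite.op (a (Fin.last n)) • f (Fin.init a)
  map_update_add' := by
    intro hd a i x y
    obtain rfl : hd = instDecidableEqFin _ := Subsingleton.elim _ _
    refine Fin.lastCases ?_ (fun i => ?_) i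
    · simp [Fin.init_update_last, add_smul]
    · have h (z : A) : Function.update a i.castSucc z (Fin.last n) = a (Fin.last n) :=
        Function.update_of_ne (Fin.castSucc_lt_last i).ne' _ _
      simp only [Fin.init_update_castSucc, MultilinearMap.map_update_add, smul_add]
      rw [h, h, h]
  map_update_smul' := by
    intro hd a i c x
    obtain rfl : hd = instDecidableEqFin _ := Subsingleton.elim _ _
    refine Fin.lastCases ?_ (fun i => ?_) i
    · simp [Fin.init_update_last]
    · have h (z : A) : Function.update a i.castSucc z (Fin.last n) = a (Fin.last n) :=
        Function.update_of_ne (Fin.castSucc_lt_last i).ne' _ _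
      simp only [Fin.init_update_castSucc, MultilinearMap.map_update_smul, smul_comm _ c]
      rw [h, h]

variable (k A M) in
/-- The Hochschild differential:
`(d f)(a₀, …, aₙ) = a₀ f(a₁, …, aₙ) + ∑_{j < n} (-1)^(j+1) f(a₀, …, aⱼ aⱼ₊₁, …, aₙ)
  + (-1)^(n+1) f(a₀, …, aₙ₋₁) aₙ`. -/
def d (n : ℕ) : Cochain k A M n →ₗ[k] Cochain k A M (n + 1) where
  toFun f := firstFace f + ∑ j : Fin n, (-1 : k) ^ ((j : ℕ) + 1) • innerFace j f
    + (-1 : k) ^ (n + 1) • lastFace f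
  map_add' f g := by
    ext a
    simp only [firstFace, innerFace, lastFace, add_apply,
      smul_apply, sum_apply, MultilinearMap.coe_mk, smul_add,
      Finset.sum_add_distrib]
    abel
  map_smul' c f := by
    ext a
    simp only [firstFace, innerFace, lastFace, add_apply,
      smul_apply, sum_apply, MultilinearMap.coe_mk, smul_add,
      Finset.smul_sum, RingHom.id_apply, smul_comm _ c]

variable (k A M) in
/-- The Hochschild coboundaries of degree `n`. -/
def coboundaries : (n : ℕ) → Submodule k (Cochain k A M n)
  | 0 => ⊥
  | n + 1 => LinearMap.range (d k A M n)

variable (k A M) in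
/-- The Hochschild cohomology `Hⁿ(A, M)`: cocycles modulo coboundaries. -/
abbrev Cohomology (n : ℕ) : Type u :=
  LinearMap.ker (d k A M n) ⧸ (coboundaries k A M n).submoduleOf (LinearMap.ker (d k A M n))

end Hochschild

/-- The Hochschild cohomological dimension
`cd(A) = sup {n | Hⁿ(A, M) ≠ 0 for some A-bimodule M}`. -/
def hochschildCohomDim (k A : Type u) [Field k] [Ring A] [Algebra k A] : ℕ∞ :=
  sSup {N : ℕ∞ | ∃ n : ℕ, N = n ∧
    ∃ (M : Type u) (_ : AddCommGroup M) (_ : Module k M) (_ : Module A M) (_ : Module Aᵐᵒᵖ M)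
      (_ : SMulCommClass A Aᵐᵒᵖ M) (_ : IsScalarTower k A M) (_ : IsScalarTower k Aᵐᵒᵖ M),
      Nontrivial (Hochschild.Cohomology k A M n)}

/-! ## Comodules and cosemisimplicity -/

section Coaction

variable {k A V : Type u} [Field k] [Ring A] [HopfAlgebra k A] [AddCommGroup V] [Module k V]

/-- `ρ : V → V ⊗ A` is a (counital, coassociative) right coaction, i.e. makes `V` a right
`A`-comodule. -/
structure IsRightCoaction (ρ : V →ₗ[k] V ⊗[k] A) : Prop where
  counit_coact : ∀ v, TensorProduct.rid k V ((Coalgebra.counit (R := k)).lTensor V (ρ v)) = v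
  coassoc : ∀ v, TensorProduct.assoc k V A A (ρ.rTensor A (ρ v)) =
    (Coalgebra.comul (R := k)).lTensor V (ρ v)

/-- The subspace `W` is a subcomodule: `ρ(W) ⊆ W ⊗ A`. -/
def IsSubcomodule (ρ : V →ₗ[k] V ⊗[k] A) (W : Submodule k V) : Prop :=
  ∀ w ∈ W, ρ w ∈ LinearMap.range (W.subtype.rTensor A)

end Coaction

/-- `A` is cosemisimple: every right `A`-comodule is semisimple, i.e. every subcomodule of a right
`A`-comodule has a complementary subcomodule. -/
def IsCosemisimple (k A : Type u) [Field k] [Ring A] [HopfAlgebra k A] : Prop :=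
  ∀ (V : Type u) [AddCommGroup V] [Module k V] (ρ : V →ₗ[k] V ⊗[k] A), IsRightCoaction ρ →
    ∀ W : Submodule k V, IsSubcomodule ρ W →
      ∃ W' : Submodule k V, IsSubcomodule ρ W' ∧ IsCompl W W'

/-- `A` is of Kac type: the antipode satisfies `S² = id`. -/
def IsKacType (k A : Type u) [Field k] [Ring A] [HopfAlgebra k A] : Prop :=
  HopfAlgebra.antipode k (A := A) ∘ₗ HopfAlgebra.antipode k = LinearMap.id

/-! ## Yetter-Drinfeld modules -/

section YD

variable {k A : Type u} [Field k] [Ring A] [HopfAlgebra k A]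

variable (k A) in
/-- The iterated comultiplication `a ↦ a₍₁₎ ⊗ (a₍₂₎ ⊗ a₍₃₎)`. -/
def comul₃ : A →ₗ[k] A ⊗[k] (A ⊗[k] A) :=
  (Coalgebra.comul (R := k)).lTensor A ∘ₗ Coalgebra.comul (R := k)

variable (k A) in
/-- `c ⊗ (x ⊗ z) ↦ S(x) c z`. -/
def sandwich : A ⊗[k] (A ⊗[k] A) →ₗ[k] A :=
  LinearMap.mul' k A ∘ₗ (HopfAlgebra.antipode k (A := A)).rTensor A ∘ₗ
    (LinearMap.mul' k A).lTensor A ∘ₗ (TensorProduct.leftComm k A A A).toLinearMap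

theorem sandwich_tmul (c x z : A) :
    sandwich k A (c ⊗ₜ (x ⊗ₜ z)) = HopfAlgebra.antipode k x * (c * z) := rfl

/-- `(v ⊗ c) ⊗ (x ⊗ (y ⊗ z)) ↦ (v ← y) ⊗ S(x) c z`. -/
def ydTwist {V : Type u} [AddCommGroup V] [Module k V] (act : V →ₗ[k] A →ₗ[k] V) :
    (V ⊗[k] A) ⊗[k] (A ⊗[k] (A ⊗[k] A)) →ₗ[k] V ⊗[k] A :=
  TensorProduct.map (TensorProduct.lift act) (sandwich k A) ∘ₗ
    (TensorProduct.tensorTensorTensorComm k V A A (A ⊗[k] A)).toLinearMap ∘ₗ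
    (TensorProduct.leftComm k A A A).toLinearMap.lTensor (V ⊗[k] A)

theorem ydTwist_tmul {V : Type u} [AddCommGroup V] [Module k V] (act : V →ₗ[k] A →ₗ[k] V)
    (v : V) (c x y z : A) :
    ydTwist act ((v ⊗ₜ c) ⊗ₜ (x ⊗ₜ (y ⊗ₜ z))) =
      act v y ⊗ₜ (HopfAlgebra.antipode k x * (c * z)) := rfl

/-- The axioms of a right-right Yetter-Drinfeld module on a vector space `V` with an action
`v ← a = act v a` and a coaction `v ↦ v₍₀₎ ⊗ v₍₁₎ = coact v`. -/
structure IsYetterDrinfeld {V : Type u} [AddCommGroup V] [Module k V]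
    (act : V →ₗ[k] A →ₗ[k] V) (coact : V →ₗ[k] V ⊗[k] A) : Prop
    extends IsRightCoaction coact where
  act_one : ∀ v, act v 1 = v
  act_mul : ∀ v a b, act v (a * b) = act (act v a) b
  /-- `(v ← a)₍₀₎ ⊗ (v ← a)₍₁₎ = (v₍₀₎ ← a₍₂₎) ⊗ S(a₍₁₎) v₍₁₎ a₍₃₎` -/
  coact_act : ∀ v a, coact (act v a) = ydTwist act (coact v ⊗ₜ comul₃ k A a)

variable (k A) in
/-- Right-right Yetter-Drinfeld modules over the Hopf algebra `A`. -/
structure YetterDrinfeld where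
  carrier : Type u
  [addCommGroup : AddCommGroup carrier]
  [module : Module k carrier]
  act : carrier →ₗ[k] A →ₗ[k] carrier
  coact : carrier →ₗ[k] carrier ⊗[k] A
  isYD : IsYetterDrinfeld act coact

namespace YetterDrinfeld

instance : CoeSort (YetterDrinfeld k A) (Type u) := ⟨carrier⟩

attribute [instance] addCommGroup module

/-- Morphisms of Yetter-Drinfeld modules: the `A`-linear and `A`-colinear maps. -/
@[ext]
structure Hom (V W : YetterDrinfeld k A) where
  lin : V →ₗ[k] W
  map_act : ∀ v a, lin (V.act v a) = W.act (lin v) a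
  map_coact : ∀ v, W.coact (lin v) = lin.rTensor A (V.coact v)

instance : Category (YetterDrinfeld k A) where
  Hom := Hom
  id V := ⟨LinearMap.id, fun _ _ => rfl, fun v => by simp⟩
  comp f g := ⟨g.lin ∘ₗ f.lin, fun v a => by simp [f.map_act, g.map_act],
    fun v => by simp [f.map_coact, g.map_coact, LinearMap.rTensor_comp]⟩

variable {U V W : YetterDrinfeld k A}

@[ext]
theorem hom_ext {f g : V ⟶ W} (h : Hom.lin f = Hom.lin g) : f = g := Hom.ext h

@[simp] theorem id_lin : Hom.lin (𝟙 V) = LinearMap.id := rfl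

@[simp] theorem comp_lin (f : U ⟶ V) (g : V ⟶ W) : Hom.lin (f ≫ g) = Hom.lin g ∘ₗ Hom.lin f := rfl

/-! ### The abelian category structure -/

instance : Zero (Hom V W) := ⟨⟨0, fun _ _ => by simp, fun _ => by simp⟩⟩
instance : Add (Hom V W) := ⟨fun f g => ⟨f.lin + g.lin,
  fun v a => by simp [f.map_act, g.map_act],
  fun v => by simp [f.map_coact, g.map_coact, LinearMap.rTensor_add]⟩⟩
instance : Neg (Hom V W) := ⟨fun f => ⟨-f.lin,
  fun v a => by simp [f.map_act],
  fun v => by simp [f.map_coact, LinearMap.rTensor_neg]⟩⟩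
instance : Sub (Hom V W) := ⟨fun f g => ⟨f.lin - g.lin,
  fun v a => by simp [f.map_act, g.map_act],
  fun v => by simp [f.map_coact, g.map_coact, LinearMap.rTensor_sub]⟩⟩
instance : SMul ℕ (Hom V W) := ⟨fun n f => ⟨n • f.lin,
  fun v a => by simp [f.map_act],
  fun v => by
    rw [← Nat.cast_smul_eq_nsmul k]
    simp [f.map_coact, LinearMap.rTensor_smul]⟩⟩
instance : SMul ℤ (Hom V W) := ⟨fun n f => ⟨n • f.lin,
  fun v a => by simp [f.map_act],
  fun v => by
    rw [← Int.cast_smul_eq_zsmul k]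
    simp [f.map_coact, LinearMap.rTensor_smul]⟩⟩

theorem lin_injective : Function.Injective (Hom.lin : Hom V W → (V →ₗ[k] W)) :=
  fun _ _ h => Hom.ext h

instance : AddCommGroup (Hom V W) :=
  lin_injective.addCommGroup _ rfl (fun _ _ => rfl) (fun _ => rfl) (fun _ _ => rfl)
    (fun _ _ => rfl) (fun _ _ => rfl)

instance : Preadditive (YetterDrinfeld k A) where
  homGroup V W := inferInstanceAs (AddCommGroup (Hom V W))
  add_comp _ _ _ f f' g := hom_ext (LinearMap.comp_add f.lin f'.lin g.lin)
  comp_add _ _ _ f g g' := hom_ext (LinearMap.add_comp f.lin g'.lin g.lin)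

@[simp] theorem zero_lin : Hom.lin (0 : V ⟶ W) = 0 := rfl
@[simp] theorem add_lin (f g : V ⟶ W) : Hom.lin (f + g) = Hom.lin f + Hom.lin g := rfl
@[simp] theorem sub_lin (f g : V ⟶ W) : Hom.lin (f - g) = Hom.lin f - Hom.lin g := rfl

theorem ydTwist_natural {X Y : Type u} [AddCommGroup X] [Module k X] [AddCommGroup Y] [Module k Y]
    (aX : X →ₗ[k] A →ₗ[k] X) (aY : Y →ₗ[k] A →ₗ[k] Y) (f : X →ₗ[k] Y)
    (ha : ∀ v a, f (aX v a) = aY (f v) a) (t : X ⊗[k] A) (s : A ⊗[k] (A ⊗[k] A)) :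
    f.rTensor A (ydTwist aX (t ⊗ₜ s)) = ydTwist aY (f.rTensor A t ⊗ₜ s) := by
  induction t with
  | zero => simp
  | add t t' h h' => simp only [add_tmul, map_add, h, h']
  | tmul v c =>
    induction s with
    | zero => simp
    | add t t' h h' => simp only [tmul_add, map_add, h, h']
    | tmul x s =>
      induction s with
      | zero => simp
      | add t t' h h' => simp only [tmul_add, map_add, h, h']
      | tmul y z => simp [ydTwist_tmul, ha]

/-- The axioms pass to the sum of the images of two compatible maps. -/
theorem isYD_of_cover {Y : Type u} [AddCommGroup Y] [Module k Y]
    (act : Y →ₗ[k] A →ₗ[k] Y) (coact : Y →ₗ[k] Y ⊗[k] A)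
    (f : V →ₗ[k] Y) (hf : ∀ v a, f (V.act v a) = act (f v) a)
    (hf' : ∀ v, coact (f v) = f.rTensor A (V.coact v))
    (g : W →ₗ[k] Y) (hg : ∀ v a, g (W.act v a) = act (g v) a)
    (hg' : ∀ v, coact (g v) = g.rTensor A (W.coact v))
    (hs : ∀ y, ∃ v w, y = f v + g w) : IsYetterDrinfeld act coact := by
  have key : ∀ (X : YetterDrinfeld k A) (f : X →ₗ[k] Y)
      (_ : ∀ v a, f (X.act v a) = act (f v) a)
      (_ : ∀ v, coact (f v) = f.rTensor A (X.coact v)) (v : X),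
      TensorProduct.rid k Y ((Coalgebra.counit (R := k)).lTensor Y (coact (f v))) = f v ∧
      TensorProduct.assoc k Y A A (coact.rTensor A (coact (f v))) =
        (Coalgebra.comul (R := k)).lTensor Y (coact (f v)) ∧
      act (f v) 1 = f v ∧ (∀ a b, act (f v) (a * b) = act (act (f v) a) b) ∧
      ∀ a, coact (act (f v) a) = ydTwist act (coact (f v) ⊗ₜ comul₃ k A a) := by
    intro X f hf hf' v
    refine ⟨?_, ?_, ?_, fun a b => ?_, fun a => ?_⟩
    · have h : ∀ t : X ⊗[k] A,
          TensorProduct.rid k Y ((Coalgebra.counit (R := k)).lTensor Y (f.rTensor A t)) =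
          f (TensorProduct.rid k X ((Coalgebra.counit (R := k)).lTensor X t)) := fun t => by
        induction t with
        | zero => simp
        | add t t' h h' => simp only [map_add, h, h']
        | tmul x a => simp
      rw [hf', h, X.isYD.counit_coact]
    · have h1 : ∀ t : X ⊗[k] A,
          TensorProduct.assoc k Y A A (coact.rTensor A (f.rTensor A t)) =
          f.rTensor (A ⊗[k] A) (TensorProduct.assoc k X A A (X.coact.rTensor A t)) := fun t => by
        induction t with
        | zero => simp
        | add t t' h h' => simp only [map_add, h, h']
        | tmul x a =>
          simp only [LinearMap.rTensor_tmul, hf']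
          generalize X.coact x = s
          induction s with
          | zero => simp
          | add t t' h h' => simp only [map_add, add_tmul, h, h']
          | tmul y b => simp
      have h2 : ∀ t : X ⊗[k] A,
          (Coalgebra.comul (R := k)).lTensor Y (f.rTensor A t) =
          f.rTensor (A ⊗[k] A) ((Coalgebra.comul (R := k)).lTensor X t) := fun t => by
        induction t with
        | zero => simp
        | add t t' h h' => simp only [map_add, h, h']
        | tmul x a => simp
      rw [hf', h1, h2, X.isYD.coassoc]
    · rw [← hf, X.isYD.act_one]
    · rw [← hf, ← hf, ← hf, X.isYD.act_mul]
    · rw [← hf, hf', hf', X.isYD.coact_act, ydTwist_natural X.act act f hf]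
  refine ⟨⟨fun y => ?_, fun y => ?_⟩, fun y => ?_, fun y a b => ?_, fun y a => ?_⟩ <;>
  · obtain ⟨v, w, rfl⟩ := hs y
    have h1 := key V f hf hf' v
    have h2 := key W g hg hg' w
    simp only [map_add, LinearMap.add_apply, add_tmul, h1, h2]

/-- The axioms pass to a subspace that is stable under the action and the coaction. -/
theorem isYD_of_injective {X : Type u} [AddCommGroup X] [Module k X]
    (act : X →ₗ[k] A →ₗ[k] X) (coact : X →ₗ[k] X ⊗[k] A)
    (f : X →ₗ[k] V) (hi : Function.Injective f)
    (hf : ∀ v a, f (act v a) = V.act (f v) a)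
    (hf' : ∀ v, V.coact (f v) = f.rTensor A (coact v)) : IsYetterDrinfeld act coact := by
  have hi1 : Function.Injective (f.rTensor A) :=
    Module.Flat.rTensor_preserves_injective_linearMap _ hi
  have hi2 : Function.Injective (f.rTensor (A ⊗[k] A)) :=
    Module.Flat.rTensor_preserves_injective_linearMap _ hi
  refine ⟨⟨fun v => hi ?_, fun v => hi2 ?_⟩, fun v => hi ?_, fun v a b => hi ?_,
    fun v a => hi1 ?_⟩
  · have h : ∀ t : X ⊗[k] A,
        TensorProduct.rid k V ((Coalgebra.counit (R := k)).lTensor V (f.rTensor A t)) =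
        f (TensorProduct.rid k X ((Coalgebra.counit (R := k)).lTensor X t)) := fun t => by
      induction t with
      | zero => simp
      | add t t' h h' => simp only [map_add, h, h']
      | tmul x a => simp
    rw [← h, ← hf', V.isYD.counit_coact]
  · have h1 : ∀ t : X ⊗[k] A,
        TensorProduct.assoc k V A A (V.coact.rTensor A (f.rTensor A t)) =
        f.rTensor (A ⊗[k] A) (TensorProduct.assoc k X A A (coact.rTensor A t)) := fun t => by
      induction t with
      | zero => simp
      | add t t' h h' => simp only [map_add, h, h']
      | tmul x a =>
        simp only [LinearMap.rTensor_tmul, hf']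
        generalize coact x = s
        induction s with
        | zero => simp
        | add t t' h h' => simp only [map_add, add_tmul, h, h']
        | tmul y b => simp
    have h2 : ∀ t : X ⊗[k] A,
        (Coalgebra.comul (R := k)).lTensor V (f.rTensor A t) =
        f.rTensor (A ⊗[k] A) ((Coalgebra.comul (R := k)).lTensor X t) := fun t => by
      induction t with
      | zero => simp
      | add t t' h h' => simp only [map_add, h, h']
      | tmul x a => simp
    rw [← h1, ← h2, ← hf', V.isYD.coassoc]
  · rw [hf, V.isYD.act_one]
  · rw [hf, hf, hf, V.isYD.act_mul]
  · rw [← hf', hf, V.isYD.coact_act, ydTwist_natural act V.act f hf, hf']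

/-- The zero Yetter-Drinfeld module. -/
def zeroObj : YetterDrinfeld k A where
  carrier := PUnit
  act := 0
  coact := 0
  isYD := ⟨⟨fun _ => rfl, fun v => by simp⟩, fun _ => rfl, fun _ _ _ => rfl,
    fun v a => by simp⟩

/-- The direct sum of two Yetter-Drinfeld modules. -/
def prod (V W : YetterDrinfeld k A) : YetterDrinfeld k A where
  carrier := V × W
  act := LinearMap.mk₂ k (fun v a => (V.act v.1 a, W.act v.2 a))
    (by intros; simp) (by intros; simp) (by intros; simp) (by intros; simp)
  coact := (LinearMap.inl k V W).rTensor A ∘ₗ V.coact ∘ₗ LinearMap.fst k V W +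
    (LinearMap.inr k V W).rTensor A ∘ₗ W.coact ∘ₗ LinearMap.snd k V W
  isYD := isYD_of_cover _ _ (LinearMap.inl k V W) (by intros; simp) (by intros; simp)
    (LinearMap.inr k V W) (by intros; simp) (by intros; simp)
    (fun y => ⟨y.1, y.2, by simp⟩)

def fst (V W : YetterDrinfeld k A) : prod V W ⟶ V where
  lin := LinearMap.fst k V W
  map_act _ _ := rfl
  map_coact v := by
    have h1 := LinearMap.rTensor_comp A (LinearMap.fst k V W) (LinearMap.inl k V W)
    have h2 := LinearMap.rTensor_comp A (LinearMap.fst k V W) (LinearMap.inr k V W)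
    rw [LinearMap.fst_comp_inl] at h1
    rw [LinearMap.fst_comp_inr] at h2
    have h1' := LinearMap.congr_fun h1 (V.coact v.1)
    have h2' := LinearMap.congr_fun h2 (W.coact v.2)
    simp only [LinearMap.rTensor_id, LinearMap.rTensor_zero, LinearMap.id_apply,
      LinearMap.zero_apply, LinearMap.comp_apply] at h1' h2'
    change V.coact v.1 = (LinearMap.fst k V W).rTensor A
      ((LinearMap.inl k V W).rTensor A (V.coact v.1) +
        (LinearMap.inr k V W).rTensor A (W.coact v.2))
    rw [map_add, ← h1', ← h2', add_zero]

def snd (V W : YetterDrinfeld k A) : prod V W ⟶ W where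
  lin := LinearMap.snd k V W
  map_act _ _ := rfl
  map_coact v := by
    have h1 := LinearMap.rTensor_comp A (LinearMap.snd k V W) (LinearMap.inl k V W)
    have h2 := LinearMap.rTensor_comp A (LinearMap.snd k V W) (LinearMap.inr k V W)
    rw [LinearMap.snd_comp_inl] at h1
    rw [LinearMap.snd_comp_inr] at h2
    have h1' := LinearMap.congr_fun h1 (V.coact v.1)
    have h2' := LinearMap.congr_fun h2 (W.coact v.2)
    simp only [LinearMap.rTensor_id, LinearMap.rTensor_zero, LinearMap.id_apply,
      LinearMap.zero_apply, LinearMap.comp_apply] at h1' h2'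
    change W.coact v.2 = (LinearMap.snd k V W).rTensor A
      ((LinearMap.inl k V W).rTensor A (V.coact v.1) +
        (LinearMap.inr k V W).rTensor A (W.coact v.2))
    rw [map_add, ← h1', ← h2', zero_add]

def inl (V W : YetterDrinfeld k A) : V ⟶ prod V W where
  lin := LinearMap.inl k V W
  map_act v a := by
    change (V.act v a, (0 : W)) = (V.act v a, W.act 0 a)
    simp
  map_coact v := by
    change (LinearMap.inl k V W).rTensor A (V.coact v) +
        (LinearMap.inr k V W).rTensor A (W.coact 0) = _
    rw [map_zero, map_zero, add_zero]
    rfl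

def inr (V W : YetterDrinfeld k A) : W ⟶ prod V W where
  lin := LinearMap.inr k V W
  map_act v a := by
    change ((0 : V), W.act v a) = (V.act 0 a, W.act v a)
    simp
  map_coact v := by
    change (LinearMap.inl k V W).rTensor A (V.coact 0) +
        (LinearMap.inr k V W).rTensor A (W.coact v) = _
    rw [map_zero, map_zero, zero_add]
    rfl

open Limits

instance : HasTerminal (YetterDrinfeld k A) :=
  (show IsTerminal (zeroObj : YetterDrinfeld k A) from
    IsTerminal.ofUniqueHom (fun _ => 0) (fun _ _ => hom_ext (LinearMap.ext fun _ => rfl))).hasTerminal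

instance : HasBinaryBiproducts (YetterDrinfeld k A) where
  has_binary_biproduct V W := HasBinaryBiproduct.mk
    ⟨_, isBinaryBilimitOfTotal
      (BinaryBicone.mk (prod V W) (fst V W) (snd V W) (inl V W) (inr V W)
        (hom_ext (LinearMap.fst_comp_inl ..)) (hom_ext (LinearMap.snd_comp_inl ..))
        (hom_ext (LinearMap.fst_comp_inr ..)) (hom_ext (LinearMap.snd_comp_inr ..)))
      (hom_ext (by
        refine LinearMap.ext fun v => ?_
        change ((v.1, (0 : W)) : V × W) + ((0 : V), v.2) = v
        exact Prod.ext (add_zero _) (zero_add _)))⟩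

instance : HasFiniteProducts (YetterDrinfeld k A) :=
  hasFiniteProducts_of_has_binary_and_terminal

/-- Factorization through an injective morphism. -/
def liftOf {X : YetterDrinfeld k A} (i : X ⟶ V) (hi : Function.Injective (Hom.lin i)) (h : U ⟶ V)
    (hr : ∀ u, Hom.lin h u ∈ LinearMap.range (Hom.lin i)) : U ⟶ X :=
  let l : U →ₗ[k] X := (LinearEquiv.ofInjective (Hom.lin i) hi).symm.toLinearMap ∘ₗ
    (Hom.lin h).codRestrict _ hr
  have hl : ∀ u, Hom.lin i (l u) = Hom.lin h u := fun u =>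
    congrArg Subtype.val ((LinearEquiv.ofInjective (Hom.lin i) hi).apply_symm_apply
      ⟨Hom.lin h u, hr u⟩)
  { lin := l
    map_act := fun v a => hi (by rw [hl, h.map_act, i.map_act, hl])
    map_coact := fun v => by
      have hi1 : Function.Injective ((Hom.lin i).rTensor A) :=
        Module.Flat.rTensor_preserves_injective_linearMap _ hi
      refine hi1 ?_
      have hc : Hom.lin i ∘ₗ l = Hom.lin h := LinearMap.ext hl
      rw [← LinearMap.comp_apply (f := (Hom.lin i).rTensor A) (g := l.rTensor A),
        ← LinearMap.rTensor_comp, hc, ← h.map_coact, ← i.map_coact, hl] }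

theorem liftOf_comp {X : YetterDrinfeld k A} (i : X ⟶ V) (hi : Function.Injective (Hom.lin i))
    (h : U ⟶ V) (hr : ∀ u, Hom.lin h u ∈ LinearMap.range (Hom.lin i)) :
    liftOf i hi h hr ≫ i = h :=
  hom_ext (LinearMap.ext fun u =>
    congrArg Subtype.val ((LinearEquiv.ofInjective (Hom.lin i) hi).apply_symm_apply
      ⟨Hom.lin h u, hr u⟩))

/-- Factorization through a surjective morphism. -/
def descOf {Q : YetterDrinfeld k A} (p : V ⟶ Q) (hp : Function.Surjective (Hom.lin p)) (h : V ⟶ U)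
    (hr : LinearMap.ker (Hom.lin p) ≤ LinearMap.ker (Hom.lin h)) : Q ⟶ U :=
  let l : Q →ₗ[k] U := (LinearMap.ker (Hom.lin p)).liftQ (Hom.lin h) hr ∘ₗ
    ((Hom.lin p).quotKerEquivOfSurjective hp).symm.toLinearMap
  have hl : ∀ v, l (Hom.lin p v) = Hom.lin h v := fun v => by
    have : ((Hom.lin p).quotKerEquivOfSurjective hp).symm (Hom.lin p v) =
        (LinearMap.ker (Hom.lin p)).mkQ v :=
      (LinearEquiv.symm_apply_eq _).2 rfl
    simp [l, this]
  { lin := l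
    map_act := fun q a => by
      obtain ⟨v, rfl⟩ := hp q
      rw [← p.map_act, hl, hl, h.map_act]
    map_coact := fun q => by
      obtain ⟨v, rfl⟩ := hp q
      have hc : l ∘ₗ Hom.lin p = Hom.lin h := LinearMap.ext hl
      rw [hl, p.map_coact, ← LinearMap.comp_apply (f := l.rTensor A),
        ← LinearMap.rTensor_comp, hc, h.map_coact] }

theorem comp_descOf {Q : YetterDrinfeld k A} (p : V ⟶ Q) (hp : Function.Surjective (Hom.lin p))
    (h : V ⟶ U) (hr : LinearMap.ker (Hom.lin p) ≤ LinearMap.ker (Hom.lin h)) :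
    p ≫ descOf p hp h hr = h :=
  hom_ext (LinearMap.ext fun v => by
    have : ((Hom.lin p).quotKerEquivOfSurjective hp).symm (Hom.lin p v) =
        (LinearMap.ker (Hom.lin p)).mkQ v :=
      (LinearEquiv.symm_apply_eq _).2 rfl
    simp [descOf, this])

theorem mono_of_injective (i : V ⟶ W) (hi : Function.Injective (Hom.lin i)) : Mono i :=
  ⟨fun _ _ e => hom_ext (LinearMap.ext fun u => hi
    (LinearMap.congr_fun (congrArg Hom.lin e) u))⟩

theorem epi_of_surjective (p : V ⟶ W) (hp : Function.Surjective (Hom.lin p)) : Epi p :=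
  ⟨fun _ _ e => hom_ext (LinearMap.ext fun w => by
    obtain ⟨v, rfl⟩ := hp w
    exact LinearMap.congr_fun (congrArg Hom.lin e) v)⟩

theorem rTensor_subtype_injective {X : Type u} [AddCommGroup X] [Module k X] (N : Submodule k X) :
    Function.Injective (N.subtype.rTensor A) :=
  Module.Flat.rTensor_preserves_injective_linearMap _ N.injective_subtype

/-- The coaction on a subcomodule. -/
def subCoact (N : Submodule k V) (hc : IsSubcomodule V.coact N) : N →ₗ[k] N ⊗[k] A :=
  (LinearEquiv.ofInjective (N.subtype.rTensor A) (rTensor_subtype_injective N)).symm.toLinearMap ∘ₗ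
    (V.coact ∘ₗ N.subtype).codRestrict _ (fun w => hc w w.2)

theorem rTensor_subCoact (N : Submodule k V) (hc : IsSubcomodule V.coact N) (v : N) :
    N.subtype.rTensor A (subCoact N hc v) = V.coact v :=
  congrArg Subtype.val ((LinearEquiv.ofInjective (N.subtype.rTensor A)
    (rTensor_subtype_injective N)).apply_symm_apply ⟨V.coact v, hc v v.2⟩)

/-- Yetter-Drinfeld submodules. -/
def sub (N : Submodule k V) (ha : ∀ v ∈ N, ∀ a, V.act v a ∈ N) (hc : IsSubcomodule V.coact N) :
    YetterDrinfeld k A where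
  carrier := N
  act := LinearMap.mk₂ k (fun v a => ⟨V.act v a, ha v v.2 a⟩)
    (by intros; ext; simp) (by intros; ext; simp) (by intros; ext; simp) (by intros; ext; simp)
  coact := subCoact N hc
  isYD := isYD_of_injective _ _ N.subtype N.injective_subtype (fun _ _ => rfl)
    (fun v => (rTensor_subCoact N hc v).symm)

def subι (N : Submodule k V) (ha : ∀ v ∈ N, ∀ a, V.act v a ∈ N) (hc : IsSubcomodule V.coact N) :
    sub N ha hc ⟶ V where
  lin := N.subtype
  map_act _ _ := rfl
  map_coact v := (rTensor_subCoact N hc v).symm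

/-- Quotients of Yetter-Drinfeld modules. -/
def quot (N : Submodule k V) (ha : ∀ v ∈ N, ∀ a, V.act v a ∈ N) (hc : IsSubcomodule V.coact N) :
    YetterDrinfeld k A where
  carrier := V ⧸ N
  act := N.liftQ (V.act.compr₂ N.mkQ) (fun v hv => LinearMap.ext fun a =>
    (Submodule.Quotient.mk_eq_zero N).2 (ha v hv a))
  coact := N.liftQ (N.mkQ.rTensor A ∘ₗ V.coact) (fun v hv => by
    obtain ⟨t, ht⟩ := hc v hv
    have h := LinearMap.rTensor_comp A N.mkQ N.subtype
    have h0 : N.mkQ ∘ₗ N.subtype = 0 := by ext v; simp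
    rw [h0, LinearMap.rTensor_zero] at h
    rw [LinearMap.mem_ker, LinearMap.comp_apply, ← ht]
    exact (LinearMap.congr_fun h t).symm)
  isYD := isYD_of_cover (V := V) (W := V) _ _ N.mkQ (fun _ _ => rfl) (fun _ => rfl)
    N.mkQ (fun _ _ => rfl) (fun _ => rfl)
    (fun y => by
      obtain ⟨v, rfl⟩ := N.mkQ_surjective y
      exact ⟨v, 0, by simp⟩)

def quotπ (N : Submodule k V) (ha : ∀ v ∈ N, ∀ a, V.act v a ∈ N) (hc : IsSubcomodule V.coact N) :
    V ⟶ quot N ha hc where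
  lin := N.mkQ
  map_act _ _ := rfl
  map_coact _ := rfl

theorem ker_act (f : V ⟶ W) : ∀ v ∈ LinearMap.ker (Hom.lin f), ∀ a,
    V.act v a ∈ LinearMap.ker (Hom.lin f) := fun v hv a => by
  rw [LinearMap.mem_ker] at *
  rw [f.map_act, hv]
  simp

theorem ker_coact (f : V ⟶ W) : IsSubcomodule V.coact (LinearMap.ker (Hom.lin f)) :=
  fun v hv => by
    have h := Module.Flat.rTensor_exact A (LinearMap.exact_subtype_ker_map (Hom.lin f))
    refine (h _).1 ?_
    rw [← f.map_coact, LinearMap.mem_ker.1 hv, map_zero]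

theorem range_act (f : V ⟶ W) : ∀ v ∈ LinearMap.range (Hom.lin f), ∀ a,
    W.act v a ∈ LinearMap.range (Hom.lin f) := by
  rintro _ ⟨v, rfl⟩ a
  exact ⟨V.act v a, f.map_act v a⟩

theorem range_coact (f : V ⟶ W) : IsSubcomodule W.coact (LinearMap.range (Hom.lin f)) := by
  rintro _ ⟨v, rfl⟩
  refine ⟨(Hom.lin f).rangeRestrict.rTensor A (V.coact v), ?_⟩
  rw [f.map_coact, ← LinearMap.comp_apply, ← LinearMap.rTensor_comp]
  rfl

def ker (f : V ⟶ W) : YetterDrinfeld k A := sub _ (ker_act f) (ker_coact f)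
def kerι (f : V ⟶ W) : ker f ⟶ V := subι _ (ker_act f) (ker_coact f)
def coker (f : V ⟶ W) : YetterDrinfeld k A := quot _ (range_act f) (range_coact f)
def cokerπ (f : V ⟶ W) : W ⟶ coker f := quotπ _ (range_act f) (range_coact f)

theorem kerι_comp (f : V ⟶ W) : kerι f ≫ f = 0 := hom_ext (LinearMap.ext fun v => v.2)

theorem comp_cokerπ (f : V ⟶ W) : f ≫ cokerπ f = 0 :=
  hom_ext (LinearMap.ext fun v => (Submodule.Quotient.mk_eq_zero _).2 ⟨v, rfl⟩)

/-- An injective morphism is a kernel of `f` as soon as its range is the kernel of `f`. -/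
def isKernel {X : YetterDrinfeld k A} (i : X ⟶ V) (f : V ⟶ W) (w : i ≫ f = 0)
    (hi : Function.Injective (Hom.lin i))
    (hr : LinearMap.ker (Hom.lin f) ≤ LinearMap.range (Hom.lin i)) :
    IsLimit (KernelFork.ofι i w) :=
  haveI := mono_of_injective i hi
  KernelFork.IsLimit.ofι' i w fun g hg =>
    ⟨liftOf i hi g (fun u => hr (LinearMap.congr_fun (congrArg Hom.lin hg) u)), liftOf_comp ..⟩

/-- A surjective morphism is a cokernel of `f` as soon as its kernel is the range of `f`. -/
def isCokernel {Q : YetterDrinfeld k A} (f : V ⟶ W) (p : W ⟶ Q) (w : f ≫ p = 0)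
    (hp : Function.Surjective (Hom.lin p))
    (hr : LinearMap.ker (Hom.lin p) ≤ LinearMap.range (Hom.lin f)) :
    IsColimit (CokernelCofork.ofπ p w) :=
  haveI := epi_of_surjective p hp
  CokernelCofork.IsColimit.ofπ' p w fun g hg =>
    ⟨descOf p hp g (fun u hu => by
      obtain ⟨v, rfl⟩ := hr hu
      exact LinearMap.congr_fun (congrArg Hom.lin hg) v), comp_descOf ..⟩

instance : HasKernels (YetterDrinfeld k A) where
  has_limit f := ⟨⟨_, isKernel (kerι f) f (kerι_comp f) (Submodule.injective_subtype _)
    (fun v hv => ⟨⟨v, hv⟩, rfl⟩)⟩⟩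

instance : HasCokernels (YetterDrinfeld k A) where
  has_colimit f := ⟨⟨_, isCokernel f (cokerπ f) (comp_cokerπ f) (Submodule.mkQ_surjective _)
    (fun _ hv => (Submodule.Quotient.mk_eq_zero _).1 hv)⟩⟩

theorem injective_of_mono (f : V ⟶ W) [Mono f] : Function.Injective (Hom.lin f) := by
  have h : kerι f = 0 := by
    rw [← cancel_mono f, kerι_comp, zero_comp]
  rw [← LinearMap.ker_eq_bot, eq_bot_iff]
  intro v hv
  exact LinearMap.congr_fun (congrArg Hom.lin h) ⟨v, hv⟩

theorem surjective_of_epi (f : V ⟶ W) [Epi f] : Function.Surjective (Hom.lin f) := by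
  have h : cokerπ f = 0 := by
    rw [← cancel_epi f, comp_cokerπ, comp_zero]
  intro w
  exact (Submodule.Quotient.mk_eq_zero _).1 (LinearMap.congr_fun (congrArg Hom.lin h) w)

instance : IsNormalMonoCategory (YetterDrinfeld k A) where
  normalMonoOfMono f _ := ⟨⟨coker f, cokerπ f, comp_cokerπ f, isKernel f (cokerπ f) _
    (injective_of_mono f) (fun _ hv => (Submodule.Quotient.mk_eq_zero _).1 hv)⟩⟩

instance : IsNormalEpiCategory (YetterDrinfeld k A) where
  normalEpiOfEpi f _ := ⟨⟨ker f, kerι f, kerι_comp f, isCokernel (kerι f) f _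
    (surjective_of_epi f) (fun v hv => ⟨⟨v, hv⟩, rfl⟩)⟩⟩

instance : Abelian (YetterDrinfeld k A) where

variable (k A) in
/-- The trivial Yetter-Drinfeld module: the base field with `c ← a = c ε(a)` and
`c ↦ c ⊗ 1`. -/
def trivial : YetterDrinfeld k A where
  carrier := k
  act := LinearMap.mk₂ k (fun c a => c * Coalgebra.counit (R := k) a)
    (by intros; simp [add_mul]) (by intros; simp [mul_assoc]) (by intros; simp [mul_add])
    (by intros; simp [mul_left_comm])
  coact := (TensorProduct.mk k k A).flip 1
  isYD := by
    refine ⟨⟨fun v => ?_, fun v => ?_⟩, fun v => ?_, fun v a b => ?_, fun v a => ?_⟩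
    · simp
    · simp [Algebra.TensorProduct.one_def]
    · simp
    · simp [mul_assoc]
    · let F : A ⊗[k] (A ⊗[k] A) →ₗ[k] A := LinearMap.mul' k A ∘ₗ
        (HopfAlgebra.antipode k (A := A)).rTensor A ∘ₗ
        (TensorProduct.lid k A ∘ₗ (Coalgebra.counit (R := k)).rTensor A).lTensor A
      have h1 : ∀ s : A ⊗[k] (A ⊗[k] A), ydTwist
          (LinearMap.mk₂ k (fun (c : k) (a : A) => c * Coalgebra.counit (R := k) a)
            (by intros; simp [add_mul]) (by intros; simp [mul_assoc])
            (by intros; simp [mul_add]) (by intros; simp [mul_left_comm]))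
          ((v ⊗ₜ[k] (1 : A)) ⊗ₜ[k] s) = v ⊗ₜ F s := by
        intro s
        induction s with
        | zero => simp
        | add t t' h h' => simp only [tmul_add, map_add, h, h']
        | tmul x s =>
          induction s with
          | zero => simp
          | add t t' h h' => simp only [tmul_add, map_add, h, h']
          | tmul y z =>
            rw [ydTwist_tmul]
            simp [F, ← smul_eq_mul, smul_tmul]
            rw [smul_tmul', smul_tmul', smul_eq_mul, smul_eq_mul, mul_comm]
            rfl
      have h2 : F (comul₃ k A a) = algebraMap k A (Coalgebra.counit (R := k) a) := by
        have h3 : (TensorProduct.lid k A ∘ₗ (Coalgebra.counit (R := k)).rTensor A) ∘ₗ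
            Coalgebra.comul (R := k) = (LinearMap.id : A →ₗ[k] A) := by
          ext x
          simp
        have h4 : F ∘ₗ comul₃ k A = LinearMap.mul' k A ∘ₗ
            (HopfAlgebra.antipode k (A := A)).rTensor A ∘ₗ Coalgebra.comul (R := k) := by
          ext x
          simp only [F, comul₃, LinearMap.comp_apply]
          rw [← LinearMap.lTensor_comp_apply, h3, LinearMap.lTensor_id, LinearMap.id_apply]
        rw [← LinearMap.comp_apply, h4]
        simp
      change (v * Coalgebra.counit (R := k) a) ⊗ₜ[k] (1 : A) = _
      refine Eq.trans ?_ (h1 (comul₃ k A a)).symm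
      rw [h2, Algebra.algebraMap_eq_smul_one, ← smul_tmul, smul_eq_mul, mul_comm]

end YetterDrinfeld

variable (k A) in
/-- The Gerstenhaber-Schack cohomology `Hⁿ_GS(A, V) = Extⁿ(k, V)`, the `Ext` being that of the
abelian category of Yetter-Drinfeld modules over `A`. -/
def GSCohomology (V : YetterDrinfeld k A) (n : ℕ) : Type (u + 1) :=
  haveI : HasExt.{u + 1} (YetterDrinfeld k A) := HasExt.standard _
  Abelian.Ext.{u + 1} (YetterDrinfeld.trivial k A) V n

instance (V : YetterDrinfeld k A) (n : ℕ) : AddCommGroup (GSCohomology k A V n) :=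
  haveI : HasExt.{u + 1} (YetterDrinfeld k A) := HasExt.standard _
  inferInstanceAs (AddCommGroup (Abelian.Ext.{u + 1} (YetterDrinfeld.trivial k A) V n))

end YD

/-- The Gerstenhaber-Schack cohomological dimension
`cd_GS(A) = sup {n | Hⁿ_GS(A, V) ≠ 0 for some Yetter-Drinfeld module V}`. -/
def gsCohomDim (k A : Type u) [Field k] [Ring A] [HopfAlgebra k A] : ℕ∞ :=
  sSup {N : ℕ∞ | ∃ n : ℕ, N = n ∧
    ∃ V : YetterDrinfeld k A, Nontrivial (GSCohomology k A V n)}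

end

/-! Both cohomologies are compared with `Ext_A(k, N)`, the Ext groups of right `A`-modules out of
the trivial module, and the same degrees turn out to be nonzero on the two sides.

Hochschild side. For a bimodule `M` put `m ◁ a = S(a₁) m a₂`, giving a right module `M^ad`. The map
`Φ(g)(a¹,…,aⁿ) = S(a¹₁⋯aⁿ₁) g(a¹₂,…,aⁿ₂)` (`barTwist`) carries the Hochschild complex of `M` to the
standard complex of `Ext_A(k, M^ad)`: since `S(a₁)a₂ = ε(a)`, left multiplication becomes trivial,
while right multiplication becomes adjoint (`barTwist_barD`). Conversely, a right module with left
action through `ε` is a bimodule whose Hochschild complex is, up to sign, already the standard one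
(`barD_counit`).

Yetter-Drinfeld side. The compatibility axiom says that the coaction `V → V ⊗ A` is `A`-linear for
the twisted action `twAct`. This gives free modules `V ⊗ A` on comodules and cofree modules `N ⊗ A`
on right modules. Cosemisimplicity makes the free ones projective (`projective_free`), so the
iterated free modules `k ⊗ A ⊗ ⋯ ⊗ A` resolve `k`. Morphisms from these into the cofree module on
`N` are linear maps `k ⊗ A ⊗ ⋯ ⊗ A → N` with one factor `A` fewer, whence `H_GS(A, N ⊗ A) = Ext_A(k,
N)`. Taking `N = M^ad` gives `cd ≤ cd_GS`.

For the reverse inequality every `V` must be a direct summand of a cofree module. Cosemisimplicity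
provides a Haar integral `h`, and `v ⊗ c ↦ v₀ h(v₁ S(c))` retracts the coaction `V → V ⊗ A`. It is
colinear by strong invariance of `h`, and `A`-linear because `S² = id` makes `h` a trace
(`IsHaar.mul_comm`, `averageLin_twAct`). So `H_GS(A, V)` is a summand of `Ext_A(k, V)`, which is the
Hochschild cohomology of `V` with left action through `ε`. -/

noncomputable section

open Coalgebra (comul counit)
open HopfAlgebra (antipode)

/-! ### Identities for the iterated comultiplication and the antipode. -/

section HopfIdentities

variable {k A : Type u} [Field k] [Ring A] [HopfAlgebra k A]

/-- Five-fold coassociativity: `(a₁ ⊗ a₂) ⊗ (a₃ ⊗ (a₄ ⊗ a₅))` regrouped as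
`a₁ ⊗ ((a₂ ⊗ (a₃ ⊗ a₄)) ⊗ a₅)`. -/
theorem map_comul_comul₃ :
    TensorProduct.map (comul (R := k)) ((comul (R := k)).lTensor A) ∘ₗ comul₃ k A =
      (TensorProduct.assoc k A A (A ⊗[k] (A ⊗[k] A))).symm.toLinearMap ∘ₗ
        ((TensorProduct.assoc k A A A).toLinearMap.lTensor A ∘ₗ
          (TensorProduct.assoc k A (A ⊗[k] A) A).toLinearMap).lTensor A ∘ₗ
        ((comul₃ k A).rTensor A).lTensor A ∘ₗ comul₃ k A := by
  simp only [comul₃, coassoc_simps]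

theorem mul_antipode_rTensor_comp_comul :
    (LinearMap.mul' k A ∘ₗ (antipode k).rTensor A) ∘ₗ comul (R := k) =
      Algebra.linearMap k A ∘ₗ counit (R := k) := by
  ext a
  simp

theorem lid_counit_comp_comul :
    ((TensorProduct.lid k A).toLinearMap ∘ₗ (counit (R := k)).rTensor A) ∘ₗ comul (R := k) =
      (LinearMap.id : A →ₗ[k] A) := by
  ext a
  simp

theorem rid_counit_comp_comul :
    ((TensorProduct.rid k A).toLinearMap ∘ₗ (counit (R := k)).lTensor A) ∘ₗ comul (R := k) =
      (LinearMap.id : A →ₗ[k] A) := by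
  ext a
  simp

/-- The antipode is an anti-coalgebra map. -/
theorem comul_comp_antipode : comul (R := k) ∘ₗ antipode k (A := A) =
    TensorProduct.map (antipode k) (antipode k) ∘ₗ
      (TensorProduct.comm k A A).toLinearMap ∘ₗ comul (R := k) := by
  -- Both sides are convolution inverses of `comul` in the linear maps `A → A ⊗ A`. For the
  -- right-hand side this is `S(a₂)a₃ ⊗ S(a₁)a₄ = ε(a) 1 ⊗ 1`: the inner pair collapses first, then
  -- the outer one.
  apply WithConv.toConv_injective
  refine (left_inv_eq_right_inv (a := WithConv.toConv (comul (R := k) (A := A))) ?_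
    LinearMap.comul_right_inv).symm
  apply WithConv.ext
  simp only [LinearMap.convMul_def, LinearMap.convOne_def, WithConv.ofConv_toConv]
  let m : A ⊗[k] A →ₗ[k] A := LinearMap.mul' k A ∘ₗ (antipode k).rTensor A
  have h1 : LinearMap.mul' k (A ⊗[k] A) ∘ₗ TensorProduct.map
      (TensorProduct.map (antipode k) (antipode k) ∘ₗ (TensorProduct.comm k A A).toLinearMap)
      LinearMap.id =
      TensorProduct.map m m ∘ₗ (TensorProduct.leftComm k A (A ⊗[k] A) A).toLinearMap ∘ₗ
        (TensorProduct.assoc k A A A).symm.toLinearMap.lTensor A ∘ₗ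
        (TensorProduct.assoc k A A (A ⊗[k] A)).toLinearMap := by
    ext x y z w
    simp [m]
  have h2 : TensorProduct.map (comul (R := k)) (comul (R := k)) ∘ₗ comul (R := k) =
      (TensorProduct.assoc k A A (A ⊗[k] A)).symm.toLinearMap ∘ₗ
        (TensorProduct.assoc k A A A).toLinearMap.lTensor A ∘ₗ
        ((comul (R := k)).rTensor A).lTensor A ∘ₗ comul₃ k A := by
    simp only [comul₃, coassoc_simps]
  have h3 : TensorProduct.map (Algebra.linearMap k A ∘ₗ counit (R := k)) m ∘ₗ
      (TensorProduct.leftComm k A A A).toLinearMap =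
      TensorProduct.mk k A A 1 ∘ₗ m ∘ₗ
        ((TensorProduct.lid k A).toLinearMap ∘ₗ (counit (R := k)).rTensor A).lTensor A := by
    ext x y z
    simp [m, Algebra.algebraMap_eq_smul_one, smul_tmul]
  calc _ = (LinearMap.mul' k (A ⊗[k] A) ∘ₗ TensorProduct.map
      (TensorProduct.map (antipode k) (antipode k) ∘ₗ (TensorProduct.comm k A A).toLinearMap)
      LinearMap.id) ∘ₗ TensorProduct.map (comul (R := k)) (comul (R := k)) ∘ₗ comul (R := k) := by
        rw [LinearMap.comp_assoc, ← LinearMap.comp_assoc _ _ (TensorProduct.map _ LinearMap.id),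
          ← TensorProduct.map_comp, LinearMap.comp_assoc, LinearMap.id_comp]
    _ = TensorProduct.map m m ∘ₗ (TensorProduct.leftComm k A (A ⊗[k] A) A).toLinearMap ∘ₗ
        ((comul (R := k)).rTensor A).lTensor A ∘ₗ comul₃ k A := by
        rw [h1, h2]
        ext a
        generalize ha : comul₃ k A a = t
        simp only [LinearMap.comp_apply, ha, LinearEquiv.coe_coe, LinearEquiv.apply_symm_apply]
        rw [← LinearMap.comp_apply (f := LinearMap.lTensor A _) (g := LinearMap.lTensor A _),
          ← LinearMap.lTensor_comp]
        simp
    _ = (TensorProduct.map (m ∘ₗ comul (R := k)) m ∘ₗ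
        (TensorProduct.leftComm k A A A).toLinearMap) ∘ₗ comul₃ k A := by
        have : (TensorProduct.leftComm k A (A ⊗[k] A) A).toLinearMap ∘ₗ
            ((comul (R := k)).rTensor A).lTensor A = (comul (R := k)).rTensor (A ⊗[k] A) ∘ₗ
            (TensorProduct.leftComm k A A A).toLinearMap := by
          ext x y z
          simp
        rw [← LinearMap.comp_assoc (comul₃ k A), this, ← LinearMap.comp_assoc,
          ← LinearMap.comp_assoc, LinearMap.rTensor, ← TensorProduct.map_comp, LinearMap.comp_id]
    _ = _ := by
        rw [show m ∘ₗ comul (R := k) = _ from mul_antipode_rTensor_comp_comul, h3, comul₃]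
        ext a
        simp only [LinearMap.comp_apply]
        rw [← LinearMap.lTensor_comp_apply, lid_counit_comp_comul, LinearMap.lTensor_id]
        have := LinearMap.congr_fun (mul_antipode_rTensor_comp_comul (k := k) (A := A)) a
        simp only [LinearMap.comp_apply] at this
        simp [m, Algebra.TensorProduct.one_def, Algebra.algebraMap_eq_smul_one]

theorem comul_antipode (a : A) : comul (R := k) (antipode k a) =
    TensorProduct.map (antipode k) (antipode k) (TensorProduct.comm k A A (comul (R := k) a)) :=
  LinearMap.congr_fun comul_comp_antipode a

theorem comul₃_one : comul₃ k A 1 = 1 ⊗ₜ (1 ⊗ₜ 1) := by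
  simp [comul₃, Algebra.TensorProduct.one_def]

theorem comul₃_mul (a b : A) : comul₃ k A (a * b) = comul₃ k A a * comul₃ k A b := by
  have h : (comul (R := k)).lTensor A =
      (Algebra.TensorProduct.map (AlgHom.id k A) (Bialgebra.comulAlgHom k A)).toLinearMap := by
    ext x y
    simp
  simp only [comul₃, LinearMap.comp_apply, Bialgebra.comul_mul, h, AlgHom.toLinearMap_apply,
    map_mul]

end HopfIdentities

/-! ## The twisted action -/

section Twisted

variable {k A : Type u} [Field k] [Ring A] [HopfAlgebra k A]
  {N N' : Type u} [AddCommGroup N] [Module k N] [AddCommGroup N'] [Module k N']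

/-- `act` is a right action of the algebra `A` on `N`. -/
structure IsRightAction (act : N →ₗ[k] A →ₗ[k] N) : Prop where
  act_one : ∀ v, act v 1 = v
  act_mul : ∀ v a b, act v (a * b) = act (act v a) b

theorem YetterDrinfeld.isRightAction (V : YetterDrinfeld k A) : IsRightAction V.act :=
  ⟨V.isYD.act_one, V.isYD.act_mul⟩

/-- The twisted action `(n ⊗ c) ← a = (n ← a₂) ⊗ S(a₁) c a₃` on `N ⊗ A`. -/
def twAct (act : N →ₗ[k] A →ₗ[k] N) : (N ⊗[k] A) →ₗ[k] A →ₗ[k] (N ⊗[k] A) :=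
  ((TensorProduct.mk k (N ⊗[k] A) (A ⊗[k] (A ⊗[k] A))).compr₂ (ydTwist act)).compl₂ (comul₃ k A)

theorem twAct_apply (act : N →ₗ[k] A →ₗ[k] N) (t : N ⊗[k] A) (a : A) :
    twAct act t a = ydTwist act (t ⊗ₜ comul₃ k A a) := rfl

theorem ydTwist_mul {act : N →ₗ[k] A →ₗ[k] N} (h : IsRightAction act) (t : N ⊗[k] A)
    (s s' : A ⊗[k] (A ⊗[k] A)) :
    ydTwist act (t ⊗ₜ (s * s')) = ydTwist act (ydTwist act (t ⊗ₜ s) ⊗ₜ s') := by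
  induction t with
  | zero => simp
  | add t t' h h' => simp only [add_tmul, map_add, h, h']
  | tmul n c =>
  induction s with
  | zero => simp
  | add t t' h h' => simp only [tmul_add, add_mul, add_tmul, map_add, h, h']
  | tmul x s =>
  induction s with
  | zero => simp
  | add t t' h h' => simp only [tmul_add, add_mul, add_tmul, map_add, h, h']
  | tmul y z =>
  induction s' with
  | zero => simp
  | add t t' h h' => simp only [tmul_add, mul_add, map_add, h, h']
  | tmul x' s =>
  induction s with
  | zero => simp
  | add t t' h h' => simp only [tmul_add, mul_add, map_add, h, h']
  | tmul y' z' =>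
    simp [ydTwist_tmul, h.act_mul, HopfAlgebra.antipode_mul_antidistrib, mul_assoc]

/-- The antipode reverses products, so `S(b₁)S(a₁) c a₃b₃ = S(a₁b₁) c a₃b₃`. Linearity of a coaction
for this action is exactly the Yetter-Drinfeld compatibility. -/
theorem isRightAction_twAct {act : N →ₗ[k] A →ₗ[k] N} (h : IsRightAction act) :
    IsRightAction (twAct act) where
  act_one t := by
    rw [twAct_apply, comul₃_one]
    induction t with
    | zero => simp
    | add t t' h h' => simp only [add_tmul, map_add, h, h']
    | tmul n c => simp [ydTwist_tmul, h.act_one]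
  act_mul t a b := by
    simp only [twAct_apply, comul₃_mul, ydTwist_mul h]

theorem rTensor_twAct {act : N →ₗ[k] A →ₗ[k] N} {act' : N' →ₗ[k] A →ₗ[k] N'} {f : N →ₗ[k] N'}
    (hf : ∀ v a, f (act v a) = act' (f v) a) (t : N ⊗[k] A) (a : A) :
    f.rTensor A (twAct act t a) = twAct act' (f.rTensor A t) a :=
  YetterDrinfeld.ydTwist_natural act act' f hf t _

/-- `id ⊗ ε` is linear for the twisted action. -/
theorem rid_counit_twAct (act : N →ₗ[k] A →ₗ[k] N) (t : N ⊗[k] A) (a : A) :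
    TensorProduct.rid k N ((counit (R := k)).lTensor N (twAct act t a)) =
      act (TensorProduct.rid k N ((counit (R := k)).lTensor N t)) a := by
  induction t with
  | zero => simp
  | add t t' h h' => simp only [map_add, LinearMap.add_apply, h, h']
  | tmul n c =>
    have h : ∀ s : A ⊗[k] (A ⊗[k] A), TensorProduct.rid k N ((counit (R := k)).lTensor N
        (ydTwist act ((n ⊗ₜ c) ⊗ₜ s))) = counit (R := k) c • act n
          (TensorProduct.lid k A ((counit (R := k)).rTensor A
            (((TensorProduct.rid k A).toLinearMap ∘ₗ (counit (R := k)).lTensor A).lTensor A s))) := by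
      intro s
      induction s with
      | zero => simp
      | add t t' h h' => simp only [tmul_add, map_add, smul_add, h, h']
      | tmul x s =>
      induction s with
      | zero => simp
      | add t t' h h' => simp only [tmul_add, map_add, smul_add, h, h']
      | tmul y z =>
        simp [ydTwist_tmul, smul_smul, mul_comm, mul_left_comm]
    rw [twAct_apply, h, comul₃, LinearMap.comp_apply, ← LinearMap.lTensor_comp_apply,
      rid_counit_comp_comul]
    simp

/-- `id ⊗ Δ` is linear for the twisted actions. -/
theorem comul_twAct (act : N →ₗ[k] A →ₗ[k] N) (t : N ⊗[k] A) (a : A) :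
    (TensorProduct.assoc k N A A).symm ((comul (R := k)).lTensor N (twAct act t a)) =
      twAct (twAct act) ((TensorProduct.assoc k N A A).symm ((comul (R := k)).lTensor N t)) a := by
  induction t with
  | zero => simp
  | add t t' h h' => simp only [map_add, LinearMap.add_apply, h, h']
  | tmul n c =>
    -- Both sides are `(n ← a₃) ⊗ S(a₂)c₁a₄ ⊗ S(a₁)c₂a₅`, that is, `L (Δ c)` of the five-fold
    -- coproduct of `a`. Expanding `Δ(S(a₁) c a₃)` and twisting twice produce two bracketings of it,
    -- identified by `map_comul_comul₃`.
    let L (D : A ⊗[k] A) : (A ⊗[k] A) ⊗[k] (A ⊗[k] (A ⊗[k] A)) →ₗ[k] (N ⊗[k] A) ⊗[k] A :=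
      (TensorProduct.assoc k N A A).symm.toLinearMap ∘ₗ
      TensorProduct.map (act n) (LinearMap.mul' k (A ⊗[k] A) ∘ₗ
        TensorProduct.map (TensorProduct.map (antipode k) (antipode k) ∘ₗ
          (TensorProduct.comm k A A).toLinearMap) (LinearMap.mulLeft k D)) ∘ₗ
      (TensorProduct.leftComm k (A ⊗[k] A) A (A ⊗[k] A)).toLinearMap
    have h1 : ∀ s : A ⊗[k] (A ⊗[k] A), (TensorProduct.assoc k N A A).symm
        ((comul (R := k)).lTensor N (ydTwist act ((n ⊗ₜ c) ⊗ₜ s))) =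
        L (comul (R := k) c) (TensorProduct.map (comul (R := k)) ((comul (R := k)).lTensor A) s) := by
      intro s
      induction s with
      | zero => simp
      | add t t' h h' => simp only [tmul_add, map_add, h, h']
      | tmul x s =>
      induction s with
      | zero => simp
      | add t t' h h' => simp only [tmul_add, map_add, h, h']
      | tmul y z => simp [ydTwist_tmul, L, comul_antipode]
    have h2 : ∀ (D : A ⊗[k] A) (s : A ⊗[k] (A ⊗[k] A)),
        ydTwist (twAct act) ((TensorProduct.assoc k N A A).symm (n ⊗ₜ D) ⊗ₜ s) =
        L D ((TensorProduct.assoc k A A (A ⊗[k] (A ⊗[k] A))).symm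
          (((TensorProduct.assoc k A A A).toLinearMap.lTensor A ∘ₗ
            (TensorProduct.assoc k A (A ⊗[k] A) A).toLinearMap).lTensor A
            (((comul₃ k A).rTensor A).lTensor A s))) := by
      intro D s
      induction s with
      | zero => simp
      | add t t' h h' => simp only [tmul_add, map_add, h, h']
      | tmul x s =>
      induction s with
      | zero => simp
      | add t t' h h' => simp only [tmul_add, map_add, h, h']
      | tmul y z =>
      induction D with
      | zero => simp [L]
      | add D D' h h' =>
        simp only [tmul_add, add_tmul, map_add, h, h', ← LinearMap.add_apply]
        congr 1
        ext
        simp [L, add_mul, tmul_add]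
      | tmul c c' =>
        simp only [TensorProduct.assoc_symm_tmul, ydTwist_tmul, twAct_apply, LinearMap.lTensor_tmul,
          LinearMap.rTensor_tmul]
        generalize comul₃ k A y = s
        induction s with
        | zero => simp
        | add t t' h h' => simp only [tmul_add, add_tmul, map_add, h, h']
        | tmul p s =>
        induction s with
        | zero => simp
        | add t t' h h' => simp only [tmul_add, add_tmul, map_add, h, h']
        | tmul q r => simp [ydTwist_tmul, L]
    rw [twAct_apply, h1, twAct_apply, LinearMap.lTensor_tmul, h2]
    congr 1
    exact LinearMap.congr_fun map_comul_comul₃ a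

end Twisted

/-! ## The Haar integral -/

section Haar

variable {k A : Type u} [Field k] [Ring A] [HopfAlgebra k A]

/-- A normalized two-sided integral on `A`. -/
structure IsHaar (h : A →ₗ[k] k) : Prop where
  one : h 1 = 1
  right : ∀ a, TensorProduct.lid k A (h.rTensor A (comul (R := k) a)) = h a • 1
  left : ∀ a, TensorProduct.rid k A (h.lTensor A (comul (R := k) a)) = h a • 1

theorem isRightCoaction_comul : IsRightCoaction (comul (R := k) (A := A)) where
  counit_coact a := by simp
  coassoc a := by simp

theorem IsKacType.antipode_antipode (hS : IsKacType k A) (a : A) :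
    antipode k (antipode k a) = a :=
  LinearMap.congr_fun hS a

/-- The functional is the projection of the comodule `A` onto `k·1` along a complementary
subcomodule `W`. It vanishes on `W` and `Δ(W) ⊆ W ⊗ A`, so invariance holds on `W`; on `k·1` it is
immediate. -/
theorem exists_right_integral (hA : IsCosemisimple k A) : ∃ h : A →ₗ[k] k, h 1 = 1 ∧
    ∀ a, TensorProduct.lid k A (h.rTensor A (comul (R := k) a)) = h a • 1 := by
  obtain ⟨W, hW, hc⟩ := hA A (comul (R := k)) isRightCoaction_comul (k ∙ (1 : A)) (by
    intro w hw
    obtain ⟨c, rfl⟩ := Submodule.mem_span_singleton.1 hw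
    exact ⟨⟨_, hw⟩ ⊗ₜ 1, by simp [Algebra.TensorProduct.one_def, smul_tmul']⟩)
  let p : A →ₗ[k] (k ∙ (1 : A)) := Submodule.projectionOnto _ _ hc
  let h : A →ₗ[k] k := counit (R := k) ∘ₗ (k ∙ (1 : A)).subtype ∘ₗ p
  have h1 : h 1 = 1 := by
    have : p 1 = ⟨1, Submodule.mem_span_singleton_self 1⟩ :=
      Submodule.projectionOnto_apply_left hc ⟨1, Submodule.mem_span_singleton_self 1⟩
    simp [h, this]
  have h0 : h ∘ₗ W.subtype = 0 := by
    ext w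
    have : p w = 0 := Submodule.projectionOnto_apply_right hc w
    simp [h, this]
  refine ⟨h, h1, fun a => ?_⟩
  obtain ⟨x, y, rfl⟩ : ∃ x : k, ∃ y : W, x • (1 : A) + y = a := by
    have ha : a ∈ (k ∙ (1 : A)) ⊔ W := hc.sup_eq_top ▸ Submodule.mem_top
    obtain ⟨v, hv, w, hw, e⟩ := Submodule.mem_sup.1 ha
    obtain ⟨c, rfl⟩ := Submodule.mem_span_singleton.1 hv
    exact ⟨c, ⟨w, hw⟩, e⟩
  obtain ⟨t, ht⟩ := hW y y.2
  have hy : h y = 0 := LinearMap.congr_fun h0 y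
  have : h.rTensor A (comul (R := k) (y : A)) = 0 := by
    rw [← ht, ← LinearMap.rTensor_comp_apply, h0, LinearMap.rTensor_zero, LinearMap.zero_apply]
  simp only [map_add, this, map_smul, h1, hy, Bialgebra.comul_one, Algebra.TensorProduct.one_def,
    LinearMap.rTensor_tmul]
  simp

/-- Applying `S` to `h(a₁)a₂ = h(a)1` at `S(a)` and using `S² = id` shows that `g = h ∘ S` satisfies
`a₁ g(a₂) = g(a)1`. Evaluating `h(a₁) g(a₂)` by either invariance then gives `g = h`. -/
theorem exists_haar (hA : IsCosemisimple k A) (hS : IsKacType k A) :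
    ∃ h : A →ₗ[k] k, IsHaar h := by
  obtain ⟨h, h1, hr⟩ := exists_right_integral hA
  let g : A →ₗ[k] k := h ∘ₗ antipode k
  have hg : ∀ a, TensorProduct.rid k A (g.lTensor A (comul (R := k) a)) = g a • 1 := by
    intro a
    have h2 := congrArg (antipode k) (hr (antipode k a))
    have h3 : ∀ t : A ⊗[k] A, antipode k (TensorProduct.lid k A (h.rTensor A
        (TensorProduct.map (antipode k) (antipode k) (TensorProduct.comm k A A t)))) =
        TensorProduct.rid k A (g.lTensor A t) := by
      intro t
      induction t with
      | zero => simp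
      | add t t' h h' => simp only [map_add, h, h']
      | tmul x y => simp [g, hS.antipode_antipode]
    rw [comul_antipode, h3] at h2
    rw [h2]
    simp [g]
  have hgh : g = h := by
    ext a
    have h2 : ∀ t : A ⊗[k] A, g (TensorProduct.lid k A (h.rTensor A t)) =
        h (TensorProduct.rid k A (g.lTensor A t)) := by
      intro t
      induction t with
      | zero => simp
      | add t t' h h' => simp only [map_add, h, h']
      | tmul x y => simp [mul_comm]
    have h3 := h2 (comul (R := k) a)
    rw [hr, hg] at h3
    simpa [g, h1] using h3.symm
  exact ⟨h, h1, hr, fun a => hgh ▸ hg a⟩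

variable {h : A →ₗ[k] k}

/-- `h(b₁ a) b₂ = h(b a₁) S(a₂)`. -/
theorem IsHaar.mulRight_rTensor_comul (hh : IsHaar h) (a b : A) :
    TensorProduct.lid k A ((h ∘ₗ LinearMap.mulRight k a).rTensor A (comul (R := k) b)) =
      TensorProduct.lid k A (TensorProduct.map (h ∘ₗ LinearMap.mulLeft k b) (antipode k)
        (comul (R := k) a)) := by
  -- The expression `h(b₁a₁) b₂a₂ S(a₃)` is computed twice: invariance of `h` at `b a₁` gives one
  -- side, and `a₂ S(a₃) = ε(a₂)` gives the other.
  let F (t : A ⊗[k] A) : A ⊗[k] (A ⊗[k] A) →ₗ[k] A :=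
    LinearMap.mul' k A ∘ₗ TensorProduct.map
      ((TensorProduct.lid k A).toLinearMap ∘ₗ h.rTensor A ∘ₗ LinearMap.mulLeft k t) (antipode k) ∘ₗ
      (TensorProduct.assoc k A A A).symm.toLinearMap
  have h1 : ∀ s : A ⊗[k] A,
      F (comul (R := k) b) (TensorProduct.assoc k A A A ((comul (R := k)).rTensor A s)) =
      TensorProduct.lid k A (TensorProduct.map (h ∘ₗ LinearMap.mulLeft k b) (antipode k) s) := by
    intro s
    induction s with
    | zero => simp
    | add t t' h h' => simp only [map_add, h, h']
    | tmul x y =>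
      simp only [F, LinearMap.rTensor_tmul, LinearMap.comp_apply, LinearEquiv.coe_coe,
        LinearEquiv.symm_apply_apply, TensorProduct.map_tmul, LinearMap.mulLeft_apply,
        ← Bialgebra.comul_mul, hh.right]
      simp
  have h2 : ∀ t s : A ⊗[k] A, F t ((comul (R := k)).lTensor A s) =
      TensorProduct.lid k A ((h ∘ₗ LinearMap.mulRight k
        (TensorProduct.rid k A ((counit (R := k)).lTensor A s))).rTensor A t) := by
    intro t s
    induction s with
    | zero => simp
    | add s s' h h' =>
      simp only [map_add, h, h']
      rw [← map_add, ← LinearMap.add_apply, ← LinearMap.rTensor_add, ← LinearMap.comp_add]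
      congr 4
      ext
      simp [mul_add]
    | tmul x y =>
    induction t with
    | zero => simp [F]
    | add t t' h h' =>
      simp only [map_add, ← h, ← h', ← LinearMap.add_apply]
      congr 1
      ext
      simp [F, add_mul]
    | tmul p q =>
      have h3 : ∀ s : A ⊗[k] A, F (p ⊗ₜ q) (x ⊗ₜ s) =
          h (p * x) • (q * LinearMap.mul' k A ((antipode k).lTensor A s)) := by
        intro s
        induction s with
        | zero => simp
        | add t t' h h' => simp only [map_add, tmul_add, mul_add, smul_add, h, h']
        | tmul y z => simp [F, mul_assoc]
      rw [LinearMap.lTensor_tmul, h3]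
      simp [Algebra.algebraMap_eq_smul_one, smul_smul, mul_comm]
  have h4 := h2 (comul (R := k) b) (comul (R := k) a)
  rw [← Coalgebra.coassoc_apply, h1] at h4
  rw [h4]
  simp

/-- `S(a₁) h(a₂ b) = b₁ h(a b₂)`. -/
theorem IsHaar.mulRight_lTensor_comul (hh : IsHaar h) (a b : A) :
    TensorProduct.rid k A (TensorProduct.map (antipode k) (h ∘ₗ LinearMap.mulRight k b)
        (comul (R := k) a)) =
      TensorProduct.rid k A ((h ∘ₗ LinearMap.mulLeft k a).lTensor A (comul (R := k) b)) := by
  -- The mirror computation, on `S(a₁) a₂b₁ h(a₃b₂)`.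
  let F (t : A ⊗[k] A) : A ⊗[k] (A ⊗[k] A) →ₗ[k] A :=
    LinearMap.mul' k A ∘ₗ TensorProduct.map (antipode k)
      ((TensorProduct.rid k A).toLinearMap ∘ₗ h.lTensor A ∘ₗ LinearMap.mulRight k t)
  have h1 : ∀ s : A ⊗[k] A, F (comul (R := k) b) ((comul (R := k)).lTensor A s) =
      TensorProduct.rid k A (TensorProduct.map (antipode k) (h ∘ₗ LinearMap.mulRight k b) s) := by
    intro s
    induction s with
    | zero => simp
    | add t t' h h' => simp only [map_add, h, h']
    | tmul x y =>
      simp only [F, LinearMap.lTensor_tmul, LinearMap.comp_apply, LinearEquiv.coe_coe,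
        TensorProduct.map_tmul, LinearMap.mulRight_apply, ← Bialgebra.comul_mul, hh.left]
      simp
  have h2 : ∀ t s : A ⊗[k] A,
      F t (TensorProduct.assoc k A A A ((comul (R := k)).rTensor A s)) =
      TensorProduct.rid k A ((h ∘ₗ LinearMap.mulLeft k
        (TensorProduct.lid k A ((counit (R := k)).rTensor A s))).lTensor A t) := by
    intro t s
    induction s with
    | zero => simp
    | add s s' h h' =>
      simp only [map_add, h, h']
      rw [← map_add, ← LinearMap.add_apply, ← LinearMap.lTensor_add, ← LinearMap.comp_add]
      congr 4
      ext
      simp [add_mul]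
    | tmul x y =>
    induction t with
    | zero => simp [F]
    | add t t' h h' =>
      simp only [map_add, ← h, ← h', ← LinearMap.add_apply]
      congr 1
      ext
      simp [F, mul_add]
    | tmul p q =>
      have h3 : ∀ s : A ⊗[k] A, F (p ⊗ₜ q) (TensorProduct.assoc k A A A (s ⊗ₜ y)) =
          h (y * q) • (LinearMap.mul' k A ((antipode k).rTensor A s) * p) := by
        intro s
        induction s with
        | zero => simp
        | add t t' h h' => simp only [map_add, add_tmul, add_mul, smul_add, h, h']
        | tmul y z => simp [F, mul_assoc]
      rw [LinearMap.rTensor_tmul, h3]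
      simp [Algebra.algebraMap_eq_smul_one, smul_smul, mul_comm]
  have h4 := h2 (comul (R := k) b) (comul (R := k) a)
  rw [Coalgebra.coassoc_apply, h1] at h4
  rw [h4]
  simp

/-- `h(b a₁) a₂ = h(b₁ a) S(b₂)`. -/
theorem IsHaar.mulLeft_rTensor_comul (hh : IsHaar h) (hS : IsKacType k A) (a b : A) :
    TensorProduct.lid k A ((h ∘ₗ LinearMap.mulLeft k b).rTensor A (comul (R := k) a)) =
      TensorProduct.lid k A (TensorProduct.map (h ∘ₗ LinearMap.mulRight k a) (antipode k)
        (comul (R := k) b)) := by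
  have h1 : ∀ (f : A →ₗ[k] k) (g g' : A →ₗ[k] A), antipode k ∘ₗ g = g' → ∀ t : A ⊗[k] A,
      antipode k (TensorProduct.lid k A (TensorProduct.map f g t)) =
      TensorProduct.lid k A (TensorProduct.map f g' t) := by
    rintro f g _ rfl t
    induction t with
    | zero => simp
    | add t t' h h' => simp only [map_add, h, h']
    | tmul x y => simp
  -- Applying `S` moves the antipode to the other side of the identity, because `S² = id`.
  have h2 := congrArg (antipode k) (hh.mulRight_rTensor_comul a b)
  rw [LinearMap.rTensor, h1 _ _ _ (LinearMap.comp_id _), h1 _ _ _ hS] at h2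
  exact h2.symm

/-- `a₁ h(a₂ b) = S(b₁) h(a b₂)`. -/
theorem IsHaar.mulRight_lTensor_comul' (hh : IsHaar h) (hS : IsKacType k A) (a b : A) :
    TensorProduct.rid k A ((h ∘ₗ LinearMap.mulRight k b).lTensor A (comul (R := k) a)) =
      TensorProduct.rid k A (TensorProduct.map (antipode k) (h ∘ₗ LinearMap.mulLeft k a)
        (comul (R := k) b)) := by
  have h1 : ∀ (f : A →ₗ[k] k) (g g' : A →ₗ[k] A), antipode k ∘ₗ g = g' → ∀ t : A ⊗[k] A,
      antipode k (TensorProduct.rid k A (TensorProduct.map g f t)) =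
      TensorProduct.rid k A (TensorProduct.map g' f t) := by
    rintro f g _ rfl t
    induction t with
    | zero => simp
    | add t t' h h' => simp only [map_add, h, h']
    | tmul x y => simp
  have h2 := congrArg (antipode k) (hh.mulRight_lTensor_comul a b)
  rw [LinearMap.lTensor, h1 _ _ _ (LinearMap.comp_id _), h1 _ _ _ hS] at h2
  exact h2

/-- `a₁ h(a₂ S(c)) = h(a S(c₁)) c₂`. -/
theorem IsHaar.mulRight_antipode_lTensor_comul (hh : IsHaar h) (hS : IsKacType k A) (a c : A) :
    TensorProduct.rid k A
        ((h ∘ₗ LinearMap.mulRight k (antipode k c)).lTensor A (comul (R := k) a)) =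
      TensorProduct.lid k A ((h ∘ₗ LinearMap.mulLeft k a ∘ₗ antipode k).rTensor A
        (comul (R := k) c)) := by
  rw [hh.mulRight_lTensor_comul' hS, comul_antipode]
  generalize comul (R := k) c = t
  induction t with
  | zero => simp
  | add t t' h h' => simp only [map_add, h, h']
  | tmul x y => simp [hS.antipode_antipode]

/-- In the Kac case, the Haar integral is a trace. -/
theorem IsHaar.mul_comm (hh : IsHaar h) (hS : IsKacType k A) (a b : A) :
    h (a * b) = h (b * a) := by
  -- The scalar `h(b₁a₁) h(a₂b₂)` is computed twice. Rewriting `h(b₁a₁)a₂` by strong invariance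
  -- gives `h(b₁a) h(S(b₂)b₃) = h(ba)`; rewriting `a₁h(a₂b₂)` gives `h(b₁S(b₂)) h(ab₃) = h(ab)`.
  let E (t : A ⊗[k] A) : A ⊗[k] A →ₗ[k] k :=
    TensorProduct.lift (LinearMap.mk₂ k
      (fun x y => h (TensorProduct.lid k A ((h ∘ₗ LinearMap.mulLeft k x).rTensor A t) * y))
      (fun x x' y => by
        have : h ∘ₗ LinearMap.mulLeft k (x + x') =
          h ∘ₗ LinearMap.mulLeft k x + h ∘ₗ LinearMap.mulLeft k x' := by ext; simp [add_mul]
        simp [this, LinearMap.rTensor_add, add_mul])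
      (fun c x y => by
        have : h ∘ₗ LinearMap.mulLeft k (c • x) = c • (h ∘ₗ LinearMap.mulLeft k x) := by
          ext; simp
        simp [this, LinearMap.rTensor_smul])
      (fun x y y' => by simp [mul_add]) (fun c x y => by simp))
  have hE : ∀ (t : A ⊗[k] A) (x y : A), E t (x ⊗ₜ y) =
      h (x * TensorProduct.rid k A ((h ∘ₗ LinearMap.mulRight k y).lTensor A t)) := by
    intro t x y
    simp only [E, TensorProduct.lift.tmul, LinearMap.mk₂_apply]
    induction t with
    | zero => simp
    | add t t' h h' => simp only [map_add, add_mul, mul_add, h, h']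
    | tmul p q => simp [_root_.mul_comm]
  let F₁ : A ⊗[k] (A ⊗[k] A) →ₗ[k] k := LinearMap.mul' k k ∘ₗ
    TensorProduct.map (h ∘ₗ LinearMap.mulRight k a) (h ∘ₗ LinearMap.mul' k A ∘ₗ
      (antipode k).rTensor A)
  let F₂ : A ⊗[k] (A ⊗[k] A) →ₗ[k] k := LinearMap.mul' k k ∘ₗ
    TensorProduct.map (h ∘ₗ LinearMap.mul' k A ∘ₗ (antipode k).lTensor A)
      (h ∘ₗ LinearMap.mulLeft k a) ∘ₗ (TensorProduct.assoc k A A A).symm.toLinearMap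
  have e₁ : ∀ s : A ⊗[k] A, E (comul (R := k) a) s =
      F₁ (TensorProduct.assoc k A A A ((comul (R := k)).rTensor A s)) := by
    intro s
    induction s with
    | zero => simp
    | add t t' h h' => simp only [map_add, h, h']
    | tmul x y =>
      simp only [E, TensorProduct.lift.tmul, LinearMap.mk₂_apply, hh.mulLeft_rTensor_comul hS,
        LinearMap.rTensor_tmul]
      generalize comul (R := k) x = t
      induction t with
      | zero => simp
      | add t t' h h' => simp only [map_add, add_mul, add_tmul, h, h']
      | tmul p q => simp [F₁]
  have e₂ : ∀ s : A ⊗[k] A, E (comul (R := k) a) s = F₂ ((comul (R := k)).lTensor A s) := by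
    intro s
    induction s with
    | zero => simp
    | add t t' h h' => simp only [map_add, h, h']
    | tmul x y =>
      rw [hE, hh.mulRight_lTensor_comul' hS, LinearMap.lTensor_tmul]
      generalize comul (R := k) y = t
      induction t with
      | zero => simp
      | add t t' h h' => simp only [map_add, mul_add, tmul_add, h, h']
      | tmul p q => simp [F₂, _root_.mul_comm]
  have g₁ : ∀ s : A ⊗[k] A, F₁ ((comul (R := k)).lTensor A s) =
      h (TensorProduct.rid k A ((counit (R := k)).lTensor A s) * a) := by
    intro s
    induction s with
    | zero => simp
    | add t t' h h' => simp only [map_add, add_mul, h, h']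
    | tmul x y => simp [F₁, Algebra.algebraMap_eq_smul_one, hh.one, _root_.mul_comm]
  have g₂ : ∀ s : A ⊗[k] A, F₂ (TensorProduct.assoc k A A A ((comul (R := k)).rTensor A s)) =
      h (a * TensorProduct.lid k A ((counit (R := k)).rTensor A s)) := by
    intro s
    induction s with
    | zero => simp
    | add t t' h h' => simp only [map_add, mul_add, h, h']
    | tmul x y => simp [F₂, Algebra.algebraMap_eq_smul_one, hh.one, _root_.mul_comm]
  have h1 := e₁ (comul (R := k) b)
  rw [Coalgebra.coassoc_apply, g₁] at h1
  have h2 := e₂ (comul (R := k) b)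
  rw [← Coalgebra.coassoc_apply, g₂] at h2
  have h3 := h2.symm.trans h1
  simpa using h3

end Haar

/-! ## Free and cofree Yetter-Drinfeld modules -/

namespace YetterDrinfeld

section Cofree

variable {k A : Type u} [Field k] [Ring A] [HopfAlgebra k A]
  {N : Type u} [AddCommGroup N] [Module k N]

/-- The coaction `id ⊗ Δ` on `N ⊗ A`. -/
def cofreeCoact (k A N : Type u) [Field k] [Ring A] [HopfAlgebra k A] [AddCommGroup N]
    [Module k N] : N ⊗[k] A →ₗ[k] (N ⊗[k] A) ⊗[k] A :=
  (TensorProduct.assoc k N A A).symm.toLinearMap ∘ₗ (comul (R := k)).lTensor N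

/-- The cofree Yetter-Drinfeld module `N ⊗ A` on a right module `N`. -/
def cofree (act : N →ₗ[k] A →ₗ[k] N) (h : IsRightAction act) : YetterDrinfeld k A where
  carrier := N ⊗[k] A
  act := twAct act
  coact := cofreeCoact k A N
  isYD :=
    { counit_coact := fun v => by
        induction v with
        | zero => simp
        | add t t' h h' => simp only [map_add, h, h']
        | tmul n c =>
          have h1 : ∀ t : A ⊗[k] A, TensorProduct.rid k (N ⊗[k] A)
              ((counit (R := k)).lTensor (N ⊗[k] A) ((TensorProduct.assoc k N A A).symm
                (n ⊗ₜ t))) =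
              n ⊗ₜ TensorProduct.rid k A ((counit (R := k)).lTensor A t) := fun t => by
            induction t with
            | zero => simp
            | add t t' h h' => simp only [map_add, tmul_add, h, h']
            | tmul x y => simp
          simp only [cofreeCoact, LinearMap.comp_apply, LinearEquiv.coe_coe,
            LinearMap.lTensor_tmul, h1]
          simp
      coassoc := fun v => by
        have h1 : ∀ v : N ⊗[k] (A ⊗[k] A), TensorProduct.assoc k (N ⊗[k] A) A A
            ((cofreeCoact k A N).rTensor A ((TensorProduct.assoc k N A A).symm v)) =
            (TensorProduct.assoc k N A (A ⊗[k] A)).symm (((TensorProduct.assoc k A A A).toLinearMap ∘ₗ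
              (comul (R := k)).rTensor A).lTensor N v) := by
          intro v
          induction v with
          | zero => simp
          | add t t' h h' => simp only [map_add, h, h']
          | tmul n t =>
          induction t with
          | zero => simp
          | add t t' h h' => simp only [map_add, tmul_add, h, h']
          | tmul x y =>
            simp only [TensorProduct.assoc_symm_tmul, LinearMap.rTensor_tmul, cofreeCoact,
              LinearMap.comp_apply, LinearEquiv.coe_coe, LinearMap.lTensor_tmul]
            generalize comul (R := k) x = t
            induction t with
            | zero => simp
            | add t t' h h' => simp only [map_add, tmul_add, add_tmul, h, h']
            | tmul x y => simp
        have h2 : ∀ v : N ⊗[k] (A ⊗[k] A),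
            (comul (R := k)).lTensor (N ⊗[k] A) ((TensorProduct.assoc k N A A).symm v) =
            (TensorProduct.assoc k N A (A ⊗[k] A)).symm
              (((comul (R := k)).lTensor A).lTensor N v) := by
          intro v
          induction v with
          | zero => simp
          | add t t' h h' => simp only [map_add, h, h']
          | tmul n t =>
          induction t with
          | zero => simp
          | add t t' h h' => simp only [map_add, tmul_add, h, h']
          | tmul x y => simp
        simp only [cofreeCoact, LinearMap.comp_apply, LinearEquiv.coe_coe] at h1 ⊢
        rw [h1, h2, ← LinearMap.lTensor_comp_apply, ← LinearMap.lTensor_comp_apply,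
          LinearMap.comp_assoc, Coalgebra.coassoc]
      act_one := (isRightAction_twAct h).act_one
      act_mul := (isRightAction_twAct h).act_mul
      coact_act := fun v a => comul_twAct act v a }

/-- The morphism to a cofree module induced by a linear map. -/
def toCofree {act : N →ₗ[k] A →ₗ[k] N} (h : IsRightAction act) {V : YetterDrinfeld k A}
    (f : V →ₗ[k] N) (hf : ∀ v a, f (V.act v a) = act (f v) a) : V ⟶ cofree act h where
  lin := f.rTensor A ∘ₗ V.coact
  map_act v a := by
    change f.rTensor A (V.coact (V.act v a)) = _
    rw [V.isYD.coact_act]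
    exact ydTwist_natural _ _ f hf _ _
  map_coact v := by
    have h1 : ∀ t : V ⊗[k] A, cofreeCoact k A N (f.rTensor A t) =
        (TensorProduct.assoc k N A A).symm (f.rTensor (A ⊗[k] A)
          ((comul (R := k)).lTensor V t)) := by
      intro t
      induction t with
      | zero => simp
      | add t t' h h' => simp only [map_add, h, h']
      | tmul x y => simp [cofreeCoact]
    have h2 : ∀ t : (V ⊗[k] A) ⊗[k] A, (TensorProduct.assoc k N A A).symm (f.rTensor (A ⊗[k] A)
          (TensorProduct.assoc k V A A t)) = (f.rTensor A).rTensor A t := by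
      intro t
      induction t with
      | zero => simp
      | add t t' h h' => simp only [map_add, h, h']
      | tmul t y =>
      induction t with
      | zero => simp
      | add t t' h h' => simp only [map_add, add_tmul, h, h']
      | tmul x z => simp
    change cofreeCoact k A N (f.rTensor A (V.coact v)) = _
    rw [h1, ← V.isYD.coassoc, h2]
    exact (LinearMap.rTensor_comp_apply A (f.rTensor A) V.coact (V.coact v)).symm

/-- The counit `id ⊗ ε` of a cofree module. -/
def cofreeCounit (k A N : Type u) [Field k] [Ring A] [HopfAlgebra k A] [AddCommGroup N]
    [Module k N] : N ⊗[k] A →ₗ[k] N :=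
  (TensorProduct.rid k N).toLinearMap ∘ₗ (counit (R := k)).lTensor N

theorem cofreeCounit_act (act : N →ₗ[k] A →ₗ[k] N) (h : IsRightAction act)
    (t : cofree act h) (a : A) :
    cofreeCounit k A N ((cofree act h).act t a) = act (cofreeCounit k A N t) a :=
  rid_counit_twAct act t a

/-- With `cofreeCounit_act` this is the universal property: morphisms `V → N ⊗ A` correspond to
`A`-linear maps `V → N`, and the counit recovers the latter. -/
theorem cofreeCounit_toCofree {act : N →ₗ[k] A →ₗ[k] N} (h : IsRightAction act)
    {V : YetterDrinfeld k A} (f : V →ₗ[k] N) (hf : ∀ v a, f (V.act v a) = act (f v) a) (v : V) :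
    cofreeCounit k A N (Hom.lin (toCofree h f hf) v) = f v := by
  have h1 : ∀ t : V ⊗[k] A, cofreeCounit k A N (f.rTensor A t) =
      f (TensorProduct.rid k V ((counit (R := k)).lTensor V t)) := by
    intro t
    induction t with
    | zero => simp
    | add t t' h h' => simp only [map_add, h, h']
    | tmul x y => simp [cofreeCounit]
  exact (h1 _).trans (congrArg f (V.isYD.counit_coact v))

theorem toCofree_congr {act : N →ₗ[k] A →ₗ[k] N} (h : IsRightAction act)
    {V : YetterDrinfeld k A} {f g : V →ₗ[k] N} (hf : ∀ v a, f (V.act v a) = act (f v) a)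
    (hg : ∀ v a, g (V.act v a) = act (g v) a) (e : f = g) : toCofree h f hf = toCofree h g hg := by
  subst e
  rfl

theorem comp_toCofree {act : N →ₗ[k] A →ₗ[k] N} (h : IsRightAction act)
    {U V : YetterDrinfeld k A} (p : U ⟶ V) (f : V →ₗ[k] N)
    (hf : ∀ v a, f (V.act v a) = act (f v) a) :
    p ≫ toCofree h f hf = toCofree h (f ∘ₗ Hom.lin p)
      (fun v a => by simp only [LinearMap.comp_apply, p.map_act, hf]) := by
  ext v
  change f.rTensor A (V.coact (Hom.lin p v)) = (f ∘ₗ Hom.lin p).rTensor A (U.coact v)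
  rw [p.map_coact, LinearMap.rTensor_comp_apply]

end Cofree

section Free

variable {k A : Type u} [Field k] [Ring A] [HopfAlgebra k A]

/-- Right multiplication on the second factor of `N ⊗ A`. -/
def mulAct (k A N : Type u) [Field k] [Ring A] [HopfAlgebra k A] [AddCommGroup N]
    [Module k N] : (N ⊗[k] A) →ₗ[k] A →ₗ[k] (N ⊗[k] A) :=
  (LinearMap.lTensorHom (R := k) N ∘ₗ (LinearMap.mul k A).flip).flip

section

variable {N : Type u} [AddCommGroup N] [Module k N]
  {M : Type u} [AddCommGroup M] [Module k M]

@[simp]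
theorem mulAct_tmul (n : N) (b a : A) : mulAct k A N (n ⊗ₜ b) a = n ⊗ₜ (b * a) := rfl

theorem isRightAction_mulAct : IsRightAction (mulAct k A N) where
  act_one t := by
    induction t with
    | zero => simp
    | add t t' h h' => simp only [map_add, LinearMap.add_apply, h, h']
    | tmul n b => simp
  act_mul t a a' := by
    induction t with
    | zero => simp
    | add t t' h h' => simp only [map_add, LinearMap.add_apply, h, h']
    | tmul n b => simp [mul_assoc]

/-- The linear extension `n ⊗ a ↦ f(n) ← a`. -/
def freeLift (act : M →ₗ[k] A →ₗ[k] M) (f : N →ₗ[k] M) : N ⊗[k] A →ₗ[k] M :=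
  TensorProduct.lift (act ∘ₗ f)

@[simp]
theorem freeLift_tmul (act : M →ₗ[k] A →ₗ[k] M) (f : N →ₗ[k] M) (n : N) (a : A) :
    freeLift act f (n ⊗ₜ a) = act (f n) a := rfl

theorem freeLift_mulAct {act : M →ₗ[k] A →ₗ[k] M} (h : IsRightAction act) (f : N →ₗ[k] M)
    (t : N ⊗[k] A) (a : A) : freeLift act f (mulAct k A N t a) = act (freeLift act f t) a := by
  induction t with
  | zero => simp
  | add t t' h h' => simp only [map_add, LinearMap.add_apply, h, h']
  | tmul n b => simp [h.act_mul]

theorem ext_of_mulAct {act : M →ₗ[k] A →ₗ[k] M} {f g : N ⊗[k] A →ₗ[k] M}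
    (hf : ∀ t a, f (mulAct k A N t a) = act (f t) a)
    (hg : ∀ t a, g (mulAct k A N t a) = act (g t) a) (h : ∀ n, f (n ⊗ₜ 1) = g (n ⊗ₜ 1)) :
    f = g := by
  ext n a
  have h1 := hf (n ⊗ₜ 1) a
  have h2 := hg (n ⊗ₜ 1) a
  simp only [mulAct_tmul, one_mul] at h1 h2
  simp [h1, h2, h]

end

/-- The coaction of the free module: `v ⊗ a ↦ (v₀ ⊗ a₂) ⊗ S(a₁) v₁ a₃`. -/
def freeCoact (V : YetterDrinfeld k A) : V ⊗[k] A →ₗ[k] (V ⊗[k] A) ⊗[k] A :=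
  freeLift (twAct (mulAct k A V)) (((TensorProduct.mk k V A).flip 1).rTensor A ∘ₗ V.coact)

/-- This is the compatibility axiom of the free module. It comes for free because `freeCoact` is the
`A`-linear extension of `v ↦ (v₀ ⊗ 1) ⊗ v₁` for the twisted action. -/
theorem freeCoact_mulAct (V : YetterDrinfeld k A) (t : V ⊗[k] A) (a : A) :
    freeCoact V (mulAct k A V t a) = twAct (mulAct k A V) (freeCoact V t) a :=
  freeLift_mulAct (isRightAction_twAct isRightAction_mulAct) _ t a

theorem freeCoact_tmul_one (V : YetterDrinfeld k A) (v : V) :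
    freeCoact V (v ⊗ₜ 1) = ((TensorProduct.mk k V A).flip 1).rTensor A (V.coact v) :=
  (isRightAction_twAct isRightAction_mulAct).act_one _

/-- The free Yetter-Drinfeld module `V ⊗ A` on the comodule `V`. -/
def free (V : YetterDrinfeld k A) : YetterDrinfeld k A where
  carrier := V ⊗[k] A
  act := mulAct k A V
  coact := freeCoact V
  isYD :=
    { counit_coact := fun v => by
        -- Both comodule axioms equate maps that are `A`-linear for right multiplication or its
        -- twists, so they need checking only on `v ⊗ 1`, where they are the axioms of the comodule
        -- `V`. The action of `V` does not enter.
        refine LinearMap.congr_fun (f := (TensorProduct.rid k _).toLinearMap ∘ₗ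
          (counit (R := k)).lTensor _ ∘ₗ freeCoact V) (g := LinearMap.id)
          (ext_of_mulAct (act := mulAct k A V) (fun t a => ?_) (fun t a => rfl) fun n => ?_) v
        · simp only [LinearMap.comp_apply, freeCoact_mulAct]
          exact rid_counit_twAct _ _ a
        · have h1 : ∀ t : V ⊗[k] A, TensorProduct.rid k _ ((counit (R := k)).lTensor _
              (((TensorProduct.mk k V A).flip 1).rTensor A t)) =
              (TensorProduct.rid k V ((counit (R := k)).lTensor V t)) ⊗ₜ (1 : A) := by
            intro t
            induction t with
            | zero => simp
            | add t t' h h' => simp only [map_add, add_tmul, h, h']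
            | tmul x y => simp [smul_tmul']
          simp only [LinearMap.comp_apply, freeCoact_tmul_one, LinearEquiv.coe_coe, h1,
            V.isYD.counit_coact, LinearMap.id_apply]
      coassoc := fun v => by
        rw [← LinearEquiv.eq_symm_apply]
        refine LinearMap.congr_fun (f := (freeCoact V).rTensor A ∘ₗ freeCoact V)
          (g := (TensorProduct.assoc k _ A A).symm.toLinearMap ∘ₗ
            (comul (R := k)).lTensor _ ∘ₗ freeCoact V)
          (ext_of_mulAct (act := twAct (twAct (mulAct k A V))) (fun t a => ?_) (fun t a => ?_)
            fun n => ?_) v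
        · simp only [LinearMap.comp_apply, freeCoact_mulAct]
          exact rTensor_twAct (freeCoact_mulAct V) _ a
        · simp only [LinearMap.comp_apply, freeCoact_mulAct]
          exact comul_twAct _ _ a
        · simp only [LinearMap.comp_apply, freeCoact_tmul_one, LinearEquiv.coe_coe]
          have h1 : ∀ t : V ⊗[k] A, (freeCoact V).rTensor A
              (((TensorProduct.mk k V A).flip 1).rTensor A t) =
              (((TensorProduct.mk k V A).flip 1).rTensor A).rTensor A (V.coact.rTensor A t) := by
            intro t
            induction t with
            | zero => simp
            | add t t' h h' => simp only [map_add, h, h']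
            | tmul x y => simp [freeCoact_tmul_one]
          have h2 : ∀ t : V ⊗[k] A, (TensorProduct.assoc k _ A A).symm ((comul (R := k)).lTensor _
              (((TensorProduct.mk k V A).flip 1).rTensor A t)) =
              (((TensorProduct.mk k V A).flip 1).rTensor A).rTensor A
                ((TensorProduct.assoc k V A A).symm ((comul (R := k)).lTensor V t)) := by
            intro t
            induction t with
            | zero => simp
            | add t t' h h' => simp only [map_add, h, h']
            | tmul x y =>
              simp only [LinearMap.rTensor_tmul, LinearMap.lTensor_tmul]
              generalize comul (R := k) y = s
              induction s with
              | zero => simp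
              | add t t' h h' => simp only [map_add, tmul_add, h, h']
              | tmul y z => simp
          rw [h1, h2, ← V.isYD.coassoc, LinearEquiv.symm_apply_apply]
      act_one := isRightAction_mulAct.act_one
      act_mul := isRightAction_mulAct.act_mul
      coact_act := fun v a => freeCoact_mulAct V v a }

/-- A colinear map `V → W` extends to a morphism from the free module on `V`. -/
def fromFree {V W : YetterDrinfeld k A} (f : V →ₗ[k] W)
    (hf : ∀ v, W.coact (f v) = f.rTensor A (V.coact v)) : free V ⟶ W where
  lin := freeLift W.act f
  map_act t a := freeLift_mulAct W.isRightAction f t a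
  map_coact t := by
    refine LinearMap.congr_fun (f := W.coact ∘ₗ freeLift W.act f)
      (g := (freeLift W.act f).rTensor A ∘ₗ freeCoact V)
      (ext_of_mulAct (act := twAct W.act) (fun t a => ?_) (fun t a => ?_) fun n => ?_) t
    · simp only [LinearMap.comp_apply, freeLift_mulAct W.isRightAction, W.isYD.coact_act]
      rfl
    · simp only [LinearMap.comp_apply, freeCoact_mulAct]
      exact rTensor_twAct (freeLift_mulAct W.isRightAction f) _ a
    · simp only [LinearMap.comp_apply, freeCoact_tmul_one, freeLift_tmul, W.isYD.act_one, hf]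
      rw [← LinearMap.rTensor_comp_apply]
      congr 2
      ext v
      simp [W.isYD.act_one]

/-- The action `V ⊗ A → V` as a morphism from the free module. -/
def freeε (V : YetterDrinfeld k A) : free V ⟶ V :=
  fromFree LinearMap.id (fun v => by simp)

theorem freeε_tmul (V : YetterDrinfeld k A) (v : V) (a : A) :
    Hom.lin (freeε V) (v ⊗ₜ[k] a) = V.act v a := rfl

theorem tmul_one_colinear (V : YetterDrinfeld k A) (v : V) :
    (free V).coact (v ⊗ₜ[k] (1 : A)) = ((TensorProduct.mk k V A).flip 1).rTensor A (V.coact v) :=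
  freeCoact_tmul_one V v

/-- Functoriality of the free module. -/
def freeMap {V W : YetterDrinfeld k A} (f : V ⟶ W) : free V ⟶ free W :=
  fromFree ((TensorProduct.mk k W A).flip 1 ∘ₗ Hom.lin f) (fun v => by
    refine (tmul_one_colinear W (Hom.lin f v)).trans ?_
    rw [f.map_coact]
    exact (LinearMap.rTensor_comp_apply A ((TensorProduct.mk k W A).flip 1) (Hom.lin f)
      (V.coact v)).symm)

theorem freeMap_tmul {V W : YetterDrinfeld k A} (f : V ⟶ W) (v : V) (a : A) :
    Hom.lin (freeMap f) (v ⊗ₜ[k] a) = Hom.lin f v ⊗ₜ[k] a := by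
  change Hom.lin f v ⊗ₜ[k] (1 * a) = _
  rw [one_mul]

end Free

/-! ## The averaging morphism -/

section Average

variable {k A : Type u} [Field k] [Ring A] [HopfAlgebra k A] {h : A →ₗ[k] k}

/-- `v ⊗ c ↦ v₀ h(v₁ S(c))`. -/
def averageLin (h : A →ₗ[k] k) (V : YetterDrinfeld k A) : V ⊗[k] A →ₗ[k] V :=
  (TensorProduct.rid k V).toLinearMap ∘ₗ (h ∘ₗ LinearMap.mul' k A).lTensor V ∘ₗ
    (TensorProduct.assoc k V A A).toLinearMap ∘ₗ TensorProduct.map V.coact (antipode k)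

theorem averageLin_tmul (h : A →ₗ[k] k) (V : YetterDrinfeld k A) (v : V) (c : A) :
    averageLin h V (v ⊗ₜ c) = TensorProduct.rid k V
      ((h ∘ₗ LinearMap.mulRight k (antipode k c)).lTensor V (V.coact v)) := by
  simp only [averageLin, LinearMap.comp_apply, TensorProduct.map_tmul]
  generalize V.coact v = t
  induction t with
  | zero => simp
  | add t t' h h' => simp only [map_add, add_tmul, h, h']
  | tmul x y => simp

/-- One has `v₀ h(v₁ S(v₂)) = v₀ ε(v₁) h(1)`, and `h(1) = 1`. -/
theorem averageLin_coact (hh : IsHaar h) (V : YetterDrinfeld k A) (v : V) :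
    averageLin h V (V.coact v) = v := by
  have h1 : ∀ t : V ⊗[k] A, averageLin h V t = TensorProduct.rid k V
      ((h ∘ₗ LinearMap.mul' k A ∘ₗ (antipode k).lTensor A).lTensor V
        (TensorProduct.assoc k V A A (V.coact.rTensor A t))) := by
    intro t
    induction t with
    | zero => simp
    | add t t' h h' => simp only [map_add, h, h']
    | tmul v c =>
      rw [averageLin_tmul, LinearMap.rTensor_tmul]
      generalize V.coact v = t
      induction t with
      | zero => simp
      | add t t' h h' => simp only [map_add, add_tmul, h, h']
      | tmul x y => simp
  have h2 : h ∘ₗ (LinearMap.mul' k A ∘ₗ (antipode k).lTensor A) ∘ₗ comul (R := k) =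
      counit (R := k) := by
    ext a
    simp [Algebra.algebraMap_eq_smul_one, hh.one]
  rw [h1, V.isYD.coassoc, ← LinearMap.lTensor_comp_apply, LinearMap.comp_assoc, h2,
    V.isYD.counit_coact]

/-- The two sides are `v₀ ⊗ v₁ h(v₂ S(c))` and `v₀ ⊗ h(v₁ S(c₁)) c₂`, equal by strong invariance in
the form `IsHaar.mulRight_antipode_lTensor_comul`. -/
theorem coact_averageLin (hh : IsHaar h) (hS : IsKacType k A) (V : YetterDrinfeld k A)
    (t : V ⊗[k] A) :
    V.coact (averageLin h V t) = (averageLin h V).rTensor A (cofreeCoact k A V t) := by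
  induction t with
  | zero => simp
  | add t t' h h' => simp only [map_add, h, h']
  | tmul v c =>
    have h1 : ∀ (p : A →ₗ[k] k) (t : V ⊗[k] A),
        V.coact (TensorProduct.rid k V (p.lTensor V t)) =
        ((TensorProduct.rid k A).toLinearMap ∘ₗ p.lTensor A).lTensor V
          (TensorProduct.assoc k V A A (V.coact.rTensor A t)) := by
      intro p t
      induction t with
      | zero => simp
      | add t t' h h' => simp only [map_add, h, h']
      | tmul x y =>
        simp only [LinearMap.lTensor_tmul, TensorProduct.rid_tmul, map_smul, LinearMap.rTensor_tmul]
        generalize V.coact x = t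
        induction t with
        | zero => simp
        | add t t' h h' => simp only [map_add, add_tmul, smul_add, h, h']
        | tmul x y => simp
    have h2 : ∀ s : A ⊗[k] A, (averageLin h V).rTensor A ((TensorProduct.assoc k V A A).symm
        (v ⊗ₜ s)) = (TensorProduct.lift (LinearMap.mk₂ k (fun a s => TensorProduct.lid k A
          ((h ∘ₗ LinearMap.mulLeft k a ∘ₗ antipode k).rTensor A s))
          (fun a a' s => by
            rw [← map_add, ← LinearMap.add_apply, ← LinearMap.rTensor_add, ← LinearMap.comp_add,
              ← LinearMap.add_comp]
            congr 5
            ext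
            simp [add_mul])
          (fun c a s => by
            rw [← map_smul, ← LinearMap.smul_apply, ← LinearMap.rTensor_smul, ← LinearMap.comp_smul,
              ← LinearMap.smul_comp]
            congr 5
            ext
            simp)
          (fun a s s' => by simp) (fun c a s => by simp))).lTensor V
          (TensorProduct.assoc k V A (A ⊗[k] A) (V.coact v ⊗ₜ s)) := by
      intro s
      induction s with
      | zero => simp
      | add t t' h h' => simp only [map_add, tmul_add, h, h']
      | tmul x y =>
        simp only [TensorProduct.assoc_symm_tmul, LinearMap.rTensor_tmul, averageLin_tmul]
        generalize V.coact v = t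
        induction t with
        | zero => simp
        | add t t' h h' => simp only [map_add, add_tmul, h, h']
        | tmul p q => simp [smul_tmul']
    rw [averageLin_tmul, h1, V.isYD.coassoc, cofreeCoact, LinearMap.comp_apply,
      LinearMap.lTensor_tmul, LinearEquiv.coe_coe, h2, ← LinearMap.lTensor_comp_apply]
    generalize V.coact v = t
    induction t with
    | zero => simp
    | add t t' h h' => simp only [map_add, add_tmul, h, h']
    | tmul x y =>
      simp only [LinearMap.lTensor_tmul, TensorProduct.assoc_tmul, TensorProduct.lift.tmul,
        LinearMap.mk₂_apply, LinearMap.comp_apply, LinearEquiv.coe_coe]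
      rw [hh.mulRight_antipode_lTensor_comul hS]

/-- Since `S² = id`, the left side is `(v₀ ← a₃) h(S(a₂) v₁ a₄ S(a₅) S(c) a₁)`. The trace property
moves `S(a₂)` to the right end, next to `a₁`; then `a₁S(a₂)` and `a₄S(a₅)` both collapse to counits,
leaving `(v₀ ← a) h(v₁ S(c))`. -/
theorem averageLin_twAct (hh : IsHaar h) (hS : IsKacType k A) (V : YetterDrinfeld k A)
    (t : V ⊗[k] A) (a : A) :
    averageLin h V (twAct V.act t a) = V.act (averageLin h V t) a := by
  induction t with
  | zero => simp
  | add t t' h h' => simp only [map_add, LinearMap.add_apply, h, h']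
  | tmul v c =>
    let m : A ⊗[k] A →ₗ[k] A := LinearMap.mul' k A ∘ₗ (antipode k).lTensor A
    let K : (V ⊗[k] A) ⊗[k] (A ⊗[k] A) →ₗ[k] V := (TensorProduct.rid k V).toLinearMap ∘ₗ
      TensorProduct.map (TensorProduct.lift V.act) (h ∘ₗ LinearMap.mul' k A) ∘ₗ
      (TensorProduct.tensorTensorTensorComm k V A A A).toLinearMap
    let G : (A ⊗[k] A) ⊗[k] (A ⊗[k] (A ⊗[k] A)) →ₗ[k] A ⊗[k] A :=
      (LinearMap.mul' k A ∘ₗ TensorProduct.map m (LinearMap.mulLeft k (antipode k c) ∘ₗ m) ∘ₗ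
        (TensorProduct.comm k _ _).toLinearMap).lTensor A ∘ₗ
      (TensorProduct.leftComm k (A ⊗[k] A) A (A ⊗[k] A)).toLinearMap
    let L : (V ⊗[k] A) →ₗ[k] (A ⊗[k] A) ⊗[k] (A ⊗[k] (A ⊗[k] A)) →ₗ[k] V :=
      ((TensorProduct.mk k _ _).compr₂ K).compl₂ G
    have hL : ∀ (v : V) (b x p q r z : A), L (v ⊗ₜ b) ((x ⊗ₜ p) ⊗ₜ (q ⊗ₜ (r ⊗ₜ z))) =
        h (b * (m (r ⊗ₜ z) * (antipode k c * m (x ⊗ₜ p)))) • V.act v q :=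
      fun _ _ _ _ _ _ _ => rfl
    have h1 : ∀ s : A ⊗[k] (A ⊗[k] A), averageLin h V (ydTwist V.act ((v ⊗ₜ c) ⊗ₜ s)) =
        L (V.coact v) ((TensorProduct.assoc k A A (A ⊗[k] (A ⊗[k] A))).symm
          (((TensorProduct.assoc k A A A).toLinearMap.lTensor A ∘ₗ
            (TensorProduct.assoc k A (A ⊗[k] A) A).toLinearMap).lTensor A
            (((comul₃ k A).rTensor A).lTensor A s))) := by
      intro s
      induction s with
      | zero => simp
      | add t t' h h' => simp only [tmul_add, map_add, h, h']
      | tmul x s =>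
      induction s with
      | zero => simp
      | add t t' h h' => simp only [tmul_add, map_add, h, h']
      | tmul y z =>
        simp only [ydTwist_tmul, averageLin_tmul, V.isYD.coact_act, LinearMap.lTensor_tmul,
          LinearMap.rTensor_tmul]
        generalize comul₃ k A y = s
        generalize V.coact v = w
        induction w with
        | zero => simp
        | add t t' h h' => simp only [add_tmul, map_add, LinearMap.add_apply, h, h']
        | tmul v b =>
        induction s with
        | zero => simp
        | add t t' h h' => simp only [tmul_add, add_tmul, map_add, h, h']
        | tmul p s =>
        induction s with
        | zero => simp
        | add t t' h h' => simp only [tmul_add, add_tmul, map_add, h, h']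
        | tmul q r =>
          simp only [LinearMap.comp_apply, LinearMap.lTensor_tmul, LinearEquiv.coe_coe,
            TensorProduct.assoc_tmul, TensorProduct.assoc_symm_tmul, hL, ydTwist_tmul,
            TensorProduct.rid_tmul, LinearMap.mulRight_apply]
          congr 1
          simp only [m, HopfAlgebra.antipode_mul_antidistrib, hS.antipode_antipode,
            LinearMap.comp_apply, LinearMap.lTensor_tmul, LinearMap.mul'_apply]
          rw [mul_assoc, hh.mul_comm hS]
          simp only [mul_assoc]
    have h2 : ∀ s : A ⊗[k] (A ⊗[k] A), L (V.coact v)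
        (TensorProduct.map (comul (R := k)) ((comul (R := k)).lTensor A) s) =
        V.act (averageLin h V (v ⊗ₜ c)) (TensorProduct.lid k A ((counit (R := k)).rTensor A
            (((TensorProduct.rid k A).toLinearMap ∘ₗ (counit (R := k)).lTensor A).lTensor A s))) := by
      intro s
      induction s with
      | zero => simp
      | add t t' h h' => simp only [map_add, h, h']
      | tmul x s =>
      induction s with
      | zero => simp
      | add t t' h h' => simp only [tmul_add, map_add, h, h']
      | tmul y z =>
        have h3 : ∀ (v : V) (b : A) (s s' : A ⊗[k] A), L (v ⊗ₜ b) (s ⊗ₜ (y ⊗ₜ s')) =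
            h (b * (m s' * (antipode k c * m s))) • V.act v y := by
          intro v b s s'
          induction s with
          | zero => simp
          | add t t' h h' => simp only [map_add, add_tmul, mul_add, add_smul, h, h']
          | tmul x p =>
          induction s' with
          | zero => simp
          | add t t' h h' => simp only [map_add, add_mul, tmul_add, mul_add, add_smul, h, h']
          | tmul r z => exact hL ..
        rw [averageLin_tmul]
        generalize V.coact v = w
        induction w with
        | zero => simp
        | add t t' h h' => simp only [map_add, LinearMap.add_apply, h, h']
        | tmul v b =>
          simp only [TensorProduct.map_tmul, LinearMap.lTensor_tmul, h3]
          simp [m, Algebra.algebraMap_eq_smul_one, smul_smul, mul_comm]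
    rw [twAct_apply, h1]
    have h4 := LinearMap.congr_fun (map_comul_comul₃ (k := k) (A := A)) a
    simp only [LinearMap.comp_apply] at h4
    refine (congrArg (L (V.coact v)) h4.symm).trans ?_
    rw [h2, comul₃, LinearMap.comp_apply, ← LinearMap.lTensor_comp_apply,
      rid_counit_comp_comul]
    simp

/-- In the cosemisimple Kac case, a Yetter-Drinfeld module is a retract of the cofree module on its
underlying right module. -/
def average (hh : IsHaar h) (hS : IsKacType k A) (V : YetterDrinfeld k A) :
    cofree V.act V.isRightAction ⟶ V where
  lin := averageLin h V
  map_act := averageLin_twAct hh hS V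
  map_coact := coact_averageLin hh hS V

theorem toCofree_average (hh : IsHaar h) (hS : IsKacType k A) (V : YetterDrinfeld k A) :
    toCofree V.isRightAction LinearMap.id (fun _ _ => rfl) ≫ average hh hS V = 𝟙 V := by
  ext v
  change averageLin h V (LinearMap.id.rTensor A (V.coact v)) = v
  rw [LinearMap.rTensor_id, LinearMap.id_apply, averageLin_coact hh]

end Average

end YetterDrinfeld

/-! ## Ext groups and projective resolutions -/

section Ext

universe w v u'

variable {C : Type u'} [Category.{v} C] [Abelian C] [HasExt.{w} C] {X Y : C}

/-- In degree `0` a coboundary would come from a map out of cohomological degree `1` of the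
resolution, and that object is zero. -/
theorem CategoryTheory.ProjectiveResolution.extMk_zero_eq_zero_iff (R : ProjectiveResolution X)
    (f : R.complex.X 0 ⟶ Y) (hf : R.complex.d 1 0 ≫ f = 0) :
    R.extMk f 1 rfl hf = 0 ↔ f = 0 := by
  refine ⟨fun h => ?_, fun h => by subst h; simp⟩
  simp only [← R.extEquivCohomologyClass.apply_eq_iff_eq,
    ProjectiveResolution.extEquivCohomologyClass_extMk,
    ProjectiveResolution.extEquivCohomologyClass_zero,
    CochainComplex.HomComplex.CohomologyClass.mk_eq_zero_iff] at h
  rw [CochainComplex.HomComplex.Cocycle.toSingleMk_mem_coboundaries_iff _ _ _ _ _ 1 (by simp)] at h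
  obtain ⟨g, hg⟩ := h
  have h0 : g = 0 := (R.cochainComplex.isZero_of_isStrictlyLE 0 1).eq_of_src _ _
  rw [h0, Limits.comp_zero] at hg
  rw [← cancel_epi (R.cochainComplexXIso (-(0 : ℕ)) 0 rfl).hom, ← hg, Limits.comp_zero]

/-- `f` is a coboundary of degree `n` of the complex of morphisms from `K` to `Y`. -/
def IsHomCoboundary {D : Type u'} [Category.{v} D] [Preadditive D] (K : ChainComplex D ℕ) {Y : D} :
    (n : ℕ) → (K.X n ⟶ Y) → Prop
  | 0, f => f = 0
  | n + 1, f => ∃ g : K.X n ⟶ Y, K.d (n + 1) n ≫ g = f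

/-- Only nonvanishing matters for the dimensions, so Ext groups are handled through a cocycle that
is not a coboundary. -/
theorem CategoryTheory.ProjectiveResolution.nontrivial_ext_iff (R : ProjectiveResolution X)
    (n : ℕ) : Nontrivial (Abelian.Ext.{w} X Y n) ↔
      ∃ f : R.complex.X n ⟶ Y, R.complex.d (n + 1) n ≫ f = 0 ∧ ¬ IsHomCoboundary R.complex n f := by
  have key : ∀ (f : R.complex.X n ⟶ Y) (hf : R.complex.d (n + 1) n ≫ f = 0),
      R.extMk f (n + 1) rfl hf = 0 ↔ IsHomCoboundary R.complex n f := by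
    intro f hf
    cases n with
    | zero => exact R.extMk_zero_eq_zero_iff f hf
    | succ n => exact R.extMk_eq_zero_iff f _ rfl hf n rfl
  rw [nontrivial_iff_exists_ne 0]
  constructor
  · rintro ⟨α, hα⟩
    obtain ⟨f, hf, rfl⟩ := R.extMk_surjective α (n + 1) rfl
    exact ⟨f, hf, fun h => hα ((key f hf).2 h)⟩
  · rintro ⟨f, hf, h⟩
    exact ⟨R.extMk f (n + 1) rfl hf, fun h' => h ((key f hf).1 h')⟩

end Ext

/-! ### The bar resolution by iterated free Yetter-Drinfeld modules. -/

namespace YetterDrinfeld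

variable {k A : Type u} [Field k] [Ring A] [HopfAlgebra k A]

/-- Kernels and cokernels are built on the underlying vector spaces, so exactness can be tested
there. -/
theorem exact_of_ker_le_range (S : ShortComplex (YetterDrinfeld k A))
    (h : LinearMap.ker (Hom.lin S.g) ≤ LinearMap.range (Hom.lin S.f)) : S.Exact := by
  rw [S.exact_iff_of_forks
    (isKernel (kerι S.g) S.g (kerι_comp S.g) (Submodule.injective_subtype _)
      (fun v hv => ⟨⟨v, hv⟩, rfl⟩))
    (isCokernel S.f (cokerπ S.f) (comp_cokerπ S.f) (Submodule.mkQ_surjective _)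
      (fun _ hv => (Submodule.Quotient.mk_eq_zero _).1 hv))]
  exact hom_ext (LinearMap.ext fun v => (Submodule.Quotient.mk_eq_zero _).2 (h v.2))

/-- Over a cosemisimple Hopf algebra, the free Yetter-Drinfeld modules are projective. -/
theorem projective_free (hA : IsCosemisimple k A) (V : YetterDrinfeld k A) :
    Projective (free V) where
  factors {E X} f e he := by
    have hs := surjective_of_epi e
    -- A subcomodule complement of the kernel is mapped bijectively onto `X` by `e`; inverting this
    -- gives a colinear section `s` of `e`, in general not `A`-linear.
    obtain ⟨W, hW, hc⟩ := hA E E.coact E.isYD.toIsRightCoaction _ (ker_coact e)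
    let q : W →ₗ[k] X := Hom.lin e ∘ₗ W.subtype
    have hq : Function.Bijective q := by
      constructor
      · rw [← LinearMap.ker_eq_bot, eq_bot_iff]
        intro w hw
        have : (w : E) ∈ LinearMap.ker (Hom.lin e) ⊓ W := ⟨hw, w.2⟩
        rw [hc.inf_eq_bot] at this
        exact Subtype.ext this
      · intro x
        obtain ⟨y, rfl⟩ := hs x
        have hy : y ∈ LinearMap.ker (Hom.lin e) ⊔ W := hc.sup_eq_top ▸ Submodule.mem_top
        obtain ⟨a, ha, w, hw, rfl⟩ := Submodule.mem_sup.1 hy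
        exact ⟨⟨w, hw⟩, by simp [q, LinearMap.mem_ker.1 ha]⟩
    let Q := LinearEquiv.ofBijective q hq
    let s : X →ₗ[k] E := W.subtype ∘ₗ Q.symm.toLinearMap
    have hes : ∀ x, Hom.lin e (s x) = x := fun x => Q.apply_symm_apply x
    have hs : ∀ x, E.coact (s x) = s.rTensor A (X.coact x) := by
      intro x
      obtain ⟨t, ht⟩ := hW (s x) (Q.symm x).2
      have h1 : q.rTensor A t = X.coact x := by
        rw [LinearMap.rTensor_comp_apply, ht, ← e.map_coact, hes]
      rw [← ht, ← h1, ← LinearMap.rTensor_comp_apply]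
      congr 2
      ext w
      simp only [s, LinearMap.comp_apply, LinearEquiv.coe_coe]
      congr 1
      exact (Q.symm_apply_apply w).symm
    -- Composing `s` with `f` on `V ⊗ 1` keeps colinearity, and the freeness of `free V` restores
    -- `A`-linearity.
    let φ : V →ₗ[k] E := s ∘ₗ Hom.lin f ∘ₗ (TensorProduct.mk k V A).flip 1
    have hφ : ∀ v, E.coact (φ v) = φ.rTensor A (V.coact v) := by
      intro v
      refine (hs _).trans ?_
      refine Eq.trans ?_ (LinearMap.rTensor_comp_apply A s _ _).symm
      refine congrArg (s.rTensor A) ?_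
      refine (f.map_coact _).trans ?_
      refine (congrArg ((Hom.lin f).rTensor A) (tmul_one_colinear V v)).trans ?_
      exact (LinearMap.rTensor_comp_apply A (Hom.lin f) ((TensorProduct.mk k V A).flip 1)
        (V.coact v)).symm
    refine ⟨fromFree φ hφ, hom_ext ?_⟩
    refine ext_of_mulAct (act := X.act) (Hom.map_act (fromFree φ hφ ≫ e)) f.map_act fun v => ?_
    change Hom.lin e (E.act (φ v) 1) = _
    rw [E.isYD.act_one]
    exact hes _

variable (k A) in
/-- The iterated free modules `k`, `k ⊗ A`, `k ⊗ A ⊗ A`, ... -/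
def bar : ℕ → YetterDrinfeld k A
  | 0 => trivial k A
  | n + 1 => free (bar n)

variable (k A) in
/-- The map `(p, a) ↦ p ⊗ a`. -/
def barTmul (n : ℕ) : bar k A n →ₗ[k] A →ₗ[k] bar k A (n + 1) :=
  TensorProduct.mk k (bar k A n) A

theorem bar_ext {n : ℕ} {N : Type*} [AddCommGroup N] [Module k N]
    {f g : bar k A (n + 1) →ₗ[k] N} (h : ∀ p a, f (barTmul k A n p a) = g (barTmul k A n p a)) :
    f = g :=
  TensorProduct.ext' h

theorem bar_act_barTmul (n : ℕ) (p : bar k A n) (b a : A) :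
    (bar k A (n + 1)).act (barTmul k A n p b) a = barTmul k A n p (b * a) := rfl

variable (k A) in
/-- The differential `p ⊗ a ↦ p ← a - ∂(p) ⊗ a` of the bar resolution. -/
def bard : (n : ℕ) → (bar k A (n + 1) ⟶ bar k A n)
  | 0 => freeε (trivial k A)
  | n + 1 => (show bar k A (n + 1 + 1) ⟶ bar k A (n + 1) from freeε (bar k A (n + 1))) -
      (show bar k A (n + 1 + 1) ⟶ bar k A (n + 1) from freeMap (bard n))

theorem bard_zero_barTmul (p : bar k A 0) (a : A) :
    Hom.lin (bard k A 0) (barTmul k A 0 p a) = (bar k A 0).act p a := rfl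

theorem bard_succ_barTmul (n : ℕ) (p : bar k A (n + 1)) (a : A) :
    Hom.lin (bard k A (n + 1)) (barTmul k A (n + 1) p a) =
      (bar k A (n + 1)).act p a - barTmul k A n (Hom.lin (bard k A n) p) a := by
  rw [bard, sub_lin, LinearMap.sub_apply]
  exact congrArg₂ _ (freeε_tmul _ p a) (freeMap_tmul _ p a)

/-- By `A`-linearity, `∂(p ← a) = ∂p ← a`, which cancels the leading term of `∂(∂p ⊗ a)`; what
remains is `∂∂p ⊗ a`, zero by induction. -/
theorem bard_bard (n : ℕ) (t : bar k A (n + 1 + 1)) :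
    Hom.lin (bard k A n) (Hom.lin (bard k A (n + 1)) t) = 0 := by
  induction n with
  | zero =>
    refine LinearMap.congr_fun (f := Hom.lin (bard k A 0) ∘ₗ Hom.lin (bard k A 1)) (g := 0)
      (bar_ext fun p a => ?_) t
    rw [LinearMap.comp_apply, bard_succ_barTmul, map_sub, Hom.map_act, bard_zero_barTmul, sub_self,
      LinearMap.zero_apply]
  | succ n ih =>
    refine LinearMap.congr_fun (f := Hom.lin (bard k A (n + 1)) ∘ₗ Hom.lin (bard k A (n + 1 + 1)))
      (g := 0) (bar_ext fun p a => ?_) t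
    rw [LinearMap.comp_apply, bard_succ_barTmul, map_sub, Hom.map_act, bard_succ_barTmul, ih,
      map_zero, LinearMap.zero_apply, sub_zero, sub_self, LinearMap.zero_apply]

/-- The map `p ↦ p ⊗ 1` is a linear contraction: `∂(p ⊗ 1) = p - ∂p ⊗ 1`. -/
theorem bard_exact (n : ℕ) : LinearMap.ker (Hom.lin (bard k A n)) ≤
    LinearMap.range (Hom.lin (bard k A (n + 1))) := fun p hp => by
  refine ⟨barTmul k A (n + 1) p 1, ?_⟩
  rw [bard_succ_barTmul, LinearMap.mem_ker.1 hp, (bar k A (n + 1)).isYD.act_one, map_zero,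
    LinearMap.zero_apply, sub_zero]

theorem bard_zero_surjective : Function.Surjective (Hom.lin (bard k A 0)) := fun p =>
  ⟨barTmul k A 0 p 1, (bar k A 0).isYD.act_one p⟩

variable (k A) in
/-- The bar complex. -/
def barComplex : ChainComplex (YetterDrinfeld k A) ℕ :=
  -- Degree `n` holds `bar (n + 1)`: the term `bar 0 = k` is the resolved object and `bard 0` the
  -- augmentation.
  ChainComplex.of (fun n => bar k A (n + 1)) (fun n => bard k A (n + 1))
    (fun n => hom_ext (LinearMap.ext fun t => bard_bard (n + 1) t))

theorem barComplex_d (n : ℕ) : (barComplex k A).d (n + 1) n = bard k A (n + 1) :=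
  ChainComplex.of_d (fun n => bar k A (n + 1)) (fun n => bard k A (n + 1)) (j := n)

/-- The bar resolution of the trivial Yetter-Drinfeld module. -/
def barResolution (hA : IsCosemisimple k A) : ProjectiveResolution (trivial k A) where
  complex := barComplex k A
  projective n := projective_free hA (bar k A n)
  π := (ChainComplex.toSingle₀Equiv _ _).symm ⟨bard k A 0, by
    rw [barComplex_d]
    exact hom_ext (LinearMap.ext fun t => bard_bard 0 t)⟩
  quasiIso := ⟨fun n => by
    cases n with
    | zero =>
      rw [ChainComplex.quasiIsoAt₀_iff, ShortComplex.quasiIso_iff_of_zeros']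
      · refine (ShortComplex.exact_and_epi_g_iff_of_iso (S₂ := ShortComplex.mk (bard k A 1)
          (bard k A 0) (hom_ext (LinearMap.ext fun t => bard_bard 0 t))) ?_).2
          ⟨exact_of_ker_le_range _ (bard_exact 0), epi_of_surjective _ bard_zero_surjective⟩
        exact ShortComplex.isoMk (Iso.refl _) (Iso.refl _) (Iso.refl _)
          ((Category.id_comp _).trans (Eq.trans (barComplex_d 0).symm (Category.comp_id _).symm))
          (by
            refine (Category.id_comp _).trans (Eq.trans ?_ (Category.comp_id _).symm)
            exact (ChainComplex.toSingle₀Equiv_symm_apply_f_zero (C := barComplex k A)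
              (bard k A 0) _).symm)
      all_goals rfl
    | succ n =>
      rw [quasiIsoAt_iff_exactAt']
      · rw [HomologicalComplex.exactAt_iff' _ (n + 1 + 1) (n + 1) n (by simp) (by simp)]
        refine exact_of_ker_le_range _ ?_
        change LinearMap.ker (Hom.lin ((barComplex k A).d _ _)) ≤
          LinearMap.range (Hom.lin ((barComplex k A).d _ _))
        rw [barComplex_d, barComplex_d]
        exact bard_exact (n + 1)
      · apply ChainComplex.exactAt_succ_single_obj⟩

end YetterDrinfeld

/-! ### Gerstenhaber-Schack cohomology through linear cochains on the bar modules. -/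

namespace YetterDrinfeld

section BarCochains

variable {k A : Type u} [Field k] [Ring A] [HopfAlgebra k A]

/-- `f` is a coboundary of the complex of morphisms from the bar complex to `V`. -/
def IsBarHomCoboundary (V : YetterDrinfeld k A) : (n : ℕ) → (bar k A (n + 1) ⟶ V) → Prop
  | 0, f => f = 0
  | n + 1, f => ∃ g : bar k A (n + 1) ⟶ V, bard k A (n + 1) ≫ g = f

theorem nontrivial_gsCohomology_iff (hA : IsCosemisimple k A) (V : YetterDrinfeld k A) (n : ℕ) :
    Nontrivial (GSCohomology k A V n) ↔ ∃ f : bar k A (n + 1) ⟶ V,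
      bard k A (n + 1) ≫ f = 0 ∧ ¬ IsBarHomCoboundary V n f := by
  have : HasExt.{u + 1} (YetterDrinfeld k A) := HasExt.standard _
  refine ((barResolution hA).nontrivial_ext_iff n).trans ?_
  have h : ∀ n, (barResolution hA).complex.d (n + 1) n = bard k A (n + 1) := barComplex_d
  rw [h]
  have h' : ∀ f : bar k A (n + 1) ⟶ V,
      IsHomCoboundary (barResolution hA).complex n f ↔ IsBarHomCoboundary V n f := by
    intro f
    cases n with
    | zero => rfl
    | succ n =>
      change (∃ g : (barResolution hA).complex.X n ⟶ V,
        (barResolution hA).complex.d (n + 1) n ≫ g = f) ↔ _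
      rw [h]
      rfl
  exact exists_congr fun f => and_congr_right fun _ => not_congr (h' f)

variable {N : Type u} [AddCommGroup N] [Module k N]

variable (k A N) in
/-- Linear maps out of `bar (n + 1) = bar n ⊗ A` are bilinear maps. -/
def barCurry (n : ℕ) : (bar k A n →ₗ[k] A →ₗ[k] N) ≃ₗ[k] (bar k A (n + 1) →ₗ[k] N) :=
  TensorProduct.lift.equiv (RingHom.id k) (bar k A n) A N

/-- The extension `p ⊗ a ↦ g(p) ← a`. -/
def barLift (act : N →ₗ[k] A →ₗ[k] N) {n : ℕ} (g : bar k A n →ₗ[k] N) :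
    bar k A (n + 1) →ₗ[k] N :=
  barCurry k A N n (act ∘ₗ g)

@[simp]
theorem barLift_barTmul (act : N →ₗ[k] A →ₗ[k] N) {n : ℕ} (g : bar k A n →ₗ[k] N)
    (p : bar k A n) (a : A) : barLift act g (barTmul k A n p a) = act (g p) a := rfl

/-- The differential of the complex of linear maps from the bar modules to a right module. -/
def barδ (act : N →ₗ[k] A →ₗ[k] N) {n : ℕ} (g : bar k A n →ₗ[k] N) : bar k A (n + 1) →ₗ[k] N :=
  barLift act g - g ∘ₗ Hom.lin (bard k A n)

/-- The coboundaries for `barδ`. -/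
def IsBarCoboundary (act : N →ₗ[k] A →ₗ[k] N) : (n : ℕ) → (bar k A n →ₗ[k] N) → Prop
  | 0, g => g = 0
  | n + 1, g => ∃ g' : bar k A n →ₗ[k] N, barδ act g' = g

variable {act : N →ₗ[k] A →ₗ[k] N}

theorem barLift_act (h : IsRightAction act) {n : ℕ} (g : bar k A n →ₗ[k] N) (t : bar k A (n + 1))
    (a : A) : barLift act g ((bar k A (n + 1)).act t a) = act (barLift act g t) a :=
  freeLift_mulAct h g t a

/-- `barLift` identifies linear maps on `bar n` with `A`-linear maps on `bar (n + 1) = bar n ⊗ A`.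
Under it, composition with the bar differential becomes `barδ`, so `barδ` computes `Ext_A(k, N)`. -/
theorem barLift_barδ (h : IsRightAction act) {n : ℕ} (g : bar k A n →ₗ[k] N) :
    barLift act (barδ act g) = barLift act g ∘ₗ Hom.lin (bard k A (n + 1)) := by
  refine bar_ext fun p a => ?_
  rw [LinearMap.comp_apply, bard_succ_barTmul, map_sub, barLift_act h]
  simp [barδ]

theorem barLift_injective (h : IsRightAction act) {n : ℕ} {g g' : bar k A n →ₗ[k] N}
    (e : barLift act g = barLift act g') : g = g' := by
  ext t
  have := LinearMap.congr_fun e (barTmul k A n t 1)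
  simpa [h.act_one] using this

theorem exists_barLift_eq {n : ℕ} (f : bar k A (n + 1) →ₗ[k] N)
    (hf : ∀ t a, f ((bar k A (n + 1)).act t a) = act (f t) a) :
    ∃ g : bar k A n →ₗ[k] N, barLift act g = f := by
  refine ⟨f ∘ₗ (barTmul k A n).flip 1, bar_ext fun p a => ?_⟩
  rw [barLift_barTmul, LinearMap.comp_apply, ← hf, LinearMap.flip_apply, bar_act_barTmul, one_mul]

theorem barLift_zero {n : ℕ} : barLift act (0 : bar k A n →ₗ[k] N) = 0 := by
  simp [barLift]

theorem toCofree_zero (h : IsRightAction act) {V : YetterDrinfeld k A} :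
    toCofree h (0 : V →ₗ[k] N) (fun v a => by simp) = 0 := by
  refine hom_ext (LinearMap.ext fun v => ?_)
  change (0 : V →ₗ[k] N).rTensor A (V.coact v) = (0 : N ⊗[k] A)
  rw [LinearMap.rTensor_zero, LinearMap.zero_apply]

/-- The bijections for free and cofree modules combine: morphisms `bar (n + 1) → N ⊗ A` are linear
maps `bar n → N`, compatibly with differentials. -/
theorem nontrivial_gsCohomology_cofree (hA : IsCosemisimple k A) (h : IsRightAction act) (n : ℕ)
    (g : bar k A n →ₗ[k] N) (hg : barδ act g = 0) (hg' : ¬ IsBarCoboundary act n g) :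
    Nontrivial (GSCohomology k A (cofree act h) n) := by
  refine (nontrivial_gsCohomology_iff hA _ n).2
    ⟨toCofree h (barLift act g) (barLift_act h g), ?_, fun hc => hg' ?_⟩
  · rw [comp_toCofree, toCofree_congr h (g := 0) _ (fun v a => by simp)
      (by rw [← barLift_barδ h, hg, barLift_zero])]
    exact toCofree_zero h
  · have hu := cofreeCounit_toCofree h (barLift act g) (barLift_act h g)
    cases n with
    | zero =>
      have hc : toCofree h (barLift act g) (barLift_act h g) = 0 := hc
      have h0 : barLift act g = 0 := by
        ext v
        rw [← hu, hc]
        exact map_zero (cofreeCounit k A N)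
      exact barLift_injective h (h0.trans barLift_zero.symm)
    | succ n =>
      obtain ⟨G, hG⟩ := hc
      obtain ⟨g', hg'⟩ := exists_barLift_eq (act := act) (cofreeCounit k A N ∘ₗ Hom.lin G)
        (fun t a => by
          refine (congrArg (cofreeCounit k A N) (Hom.map_act G t a)).trans ?_
          exact cofreeCounit_act act h _ a)
      refine ⟨g', barLift_injective h ?_⟩
      rw [barLift_barδ h, hg']
      ext v
      rw [← hu, ← hG]
      rfl

/-- The passage from `H_GS(A, V)` to `Ext_A(k, V)` that forgets the coaction is injective, because
the averaging morphism makes `V` a retract of a cofree module. -/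
theorem exists_barδ_of_nontrivial_gsCohomology (hA : IsCosemisimple k A) (hS : IsKacType k A)
    (V : YetterDrinfeld k A) (n : ℕ) (hV : Nontrivial (GSCohomology k A V n)) :
    ∃ g : bar k A n →ₗ[k] V, barδ V.act g = 0 ∧ ¬ IsBarCoboundary V.act n g := by
  obtain ⟨h, hh⟩ := exists_haar hA hS
  obtain ⟨f, hf, hf'⟩ := (nontrivial_gsCohomology_iff hA _ n).1 hV
  have hr := V.isRightAction
  obtain ⟨g, hg⟩ := exists_barLift_eq (Hom.lin f) (Hom.map_act f)
  refine ⟨g, barLift_injective hr ?_, fun hc => hf' ?_⟩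
  · rw [barLift_barδ hr, hg, barLift_zero]
    exact congrArg Hom.lin hf
  · cases n with
    | zero =>
      have hc : g = 0 := hc
      refine hom_ext ?_
      rw [hc, barLift_zero] at hg
      exact hg.symm
    | succ n =>
      obtain ⟨g', rfl⟩ := hc
      -- The primitive `barLift g'` of `f` need not be colinear. It is made so by passing through
      -- the cofree module and averaging; naturality of `toCofree` and the retraction identity show
      -- that its differential is still `f`.
      refine ⟨toCofree hr (barLift V.act g') (barLift_act hr g') ≫ average hh hS V, ?_⟩
      rw [← Category.assoc, comp_toCofree, toCofree_congr hr (g := Hom.lin f) _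
        (Hom.map_act f) (by rw [← barLift_barδ hr, hg])]
      have := comp_toCofree hr f LinearMap.id (fun _ _ => rfl)
      rw [toCofree_congr hr (g := Hom.lin f) _ (Hom.map_act f) (LinearMap.id_comp _)] at this
      rw [← this, Category.assoc, toCofree_average, Category.comp_id]

end BarCochains

end YetterDrinfeld

/-! ## Hochschild cochains as linear maps out of the bar modules -/

namespace YetterDrinfeld

section Hochschild

variable {k A : Type u} [Field k] [Ring A] [HopfAlgebra k A]

variable (k A) in
/-- The pure tensor `1 ⊗ a₁ ⊗ ⋯ ⊗ aₙ`. -/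
def barMk : (n : ℕ) → (Fin n → A) → bar k A n
  | 0, _ => (1 : k)
  | n + 1, a => barTmul k A n (barMk n (Fin.init a)) (a (Fin.last n))

theorem barMk_succ (n : ℕ) (a : Fin (n + 1) → A) :
    barMk k A (n + 1) a = barTmul k A n (barMk k A n (Fin.init a)) (a (Fin.last n)) := rfl

variable (k A) in
/-- Linear maps out of `bar n` are Hochschild cochains. -/
def barCochain : (n : ℕ) → (M : Type u) → [AddCommGroup M] → [Module k M] →
    ((bar k A n →ₗ[k] M) ≃ₗ[k] Hochschild.Cochain k A M n)
  | 0, M, _, _ => (show (bar k A 0 →ₗ[k] M) ≃ₗ[k] M from LinearMap.ringLmapEquivSelf k k M).trans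
      (MultilinearMap.constLinearEquivOfIsEmpty k k (fun _ : Fin 0 => A) M)
  | n + 1, M, _, _ => ((barCurry k A M n).symm.trans (barCochain n (A →ₗ[k] M))).trans
      (multilinearCurryRightEquiv k (fun _ : Fin (n + 1) => A) M).symm

theorem barCochain_apply (n : ℕ) (M : Type u) [AddCommGroup M] [Module k M]
    (g : bar k A n →ₗ[k] M) (a : Fin n → A) : barCochain k A n M g a = g (barMk k A n a) := by
  induction n generalizing M with
  | zero => rfl
  | succ n ih =>
    change barCochain k A n (A →ₗ[k] M) ((barCurry k A M n).symm g) (Fin.init a)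
      (a (Fin.last n)) = _
    rw [ih]
    rfl

theorem barMk_act (n : ℕ) (a : Fin (n + 1) → A) (b : A) :
    (bar k A (n + 1)).act (barMk k A (n + 1) a) b =
      barTmul k A n (barMk k A n (Fin.init a)) (a (Fin.last n) * b) := rfl

variable {M : Type u} [AddCommGroup M] [Module k M]

/-- The restriction of `g` to `bar n ⊗ a`. -/
def barSlice {n : ℕ} : (bar k A (n + 1) →ₗ[k] M) ≃ₗ[k] (A →ₗ[k] bar k A n →ₗ[k] M) :=
  (barCurry k A M n).symm.trans LinearMap.lflip

@[simp]
theorem barSlice_apply {n : ℕ} (g : bar k A (n + 1) →ₗ[k] M) (a : A) (p : bar k A n) :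
    barSlice g a p = g (barTmul k A n p a) := rfl

/-- All the faces but the last one: on `bar (n + 1) = bar n ⊗ A`,
`p ⊗ a ↦ g(p ← a) - E(g(- ⊗ a))(p)`, and `1 ⊗ a ↦ a g(1)` for `n = 0`. -/
def barE (l : A →ₗ[k] M →ₗ[k] M) : (n : ℕ) → (bar k A n →ₗ[k] M) →ₗ[k] (bar k A (n + 1) →ₗ[k] M)
  | 0 => (barCurry k A M 0).toLinearMap ∘ₗ LinearMap.llcomp k (bar k A 0) M (A →ₗ[k] M) l.flip
  | n + 1 => LinearMap.lcomp k M (barCurry k A _ (n + 1) (bar k A (n + 1)).act) -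
      barSlice.symm.toLinearMap ∘ₗ LinearMap.llcomp k A _ _ (barE l n) ∘ₗ barSlice.toLinearMap

theorem barE_zero_barTmul (l : A →ₗ[k] M →ₗ[k] M) (g : bar k A 0 →ₗ[k] M) (p : bar k A 0) (a : A) :
    barE l 0 g (barTmul k A 0 p a) = l a (g p) := rfl

theorem barE_succ_barTmul (l : A →ₗ[k] M →ₗ[k] M) (n : ℕ) (g : bar k A (n + 1) →ₗ[k] M)
    (p : bar k A (n + 1)) (a : A) :
    barE l (n + 1) g (barTmul k A (n + 1) p a) =
      g ((bar k A (n + 1)).act p a) - barE l n (barSlice g a) p := rfl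

/-- With trivial left action, `barE` obeys the recursion that defines the bar differential. -/
theorem barE_counit {l : A →ₗ[k] M →ₗ[k] M} (hl : ∀ a m, l a m = counit (R := k) a • m) (n : ℕ)
    (g : bar k A n →ₗ[k] M) : barE l n g = g ∘ₗ Hom.lin (bard k A n) := by
  induction n with
  | zero =>
    refine bar_ext fun p a => ?_
    rw [barE_zero_barTmul, hl, LinearMap.comp_apply, bard_zero_barTmul, ← map_smul]
    congr 1
    exact mul_comm (counit (R := k) a) (show k from p)
  | succ n ih =>
    refine bar_ext fun p a => ?_
    rw [barE_succ_barTmul, ih]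
    change _ = g (Hom.lin (bard k A (n + 1)) (barTmul k A (n + 1) p a))
    rw [bard_succ_barTmul, map_sub]
    rfl

/-- The recursion for `barE` peels off the last tensor factor, so signs are counted from the right.
The factor `(-1)ⁿ` converts them to the Hochschild convention; it affects neither cocycles nor
coboundaries. -/
theorem barE_barMk (l : A →ₗ[k] M →ₗ[k] M) (n : ℕ) (g : bar k A n →ₗ[k] M) (a : Fin (n + 1) → A) :
    barE l n g (barMk k A (n + 1) a) = (-1 : k) ^ n • (l (a 0) (g (barMk k A n (Fin.tail a))) +
      ∑ j : Fin n, (-1 : k) ^ ((j : ℕ) + 1) •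
        g (barMk k A n (Fin.contractNth j.castSucc (· * ·) a))) := by
  induction n with
  | zero =>
    rw [barMk_succ, barE_zero_barTmul]
    simp
    rfl
  | succ n ih =>
    rw [barMk_succ, barE_succ_barTmul, ih, Fin.sum_univ_castSucc]
    have h0 : barSlice g (a (Fin.last (n + 1))) (barMk k A n (Fin.tail (Fin.init a))) =
        g (barMk k A (n + 1) (Fin.tail a)) := rfl
    -- Contractions away from the last entry commute with splitting it off; `h2` supplies the
    -- remaining contraction, of the last two entries.
    have h1 (j : Fin n) : barSlice g (a (Fin.last (n + 1)))
        (barMk k A n (Fin.contractNth j.castSucc (· * ·) (Fin.init a))) =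
        g (barMk k A (n + 1) (Fin.contractNth j.castSucc.castSucc (· * ·) a)) := by
      rw [barSlice_apply, barMk_succ]
      have e1 : Fin.init (Fin.contractNth j.castSucc.castSucc (· * ·) a) =
          Fin.contractNth j.castSucc (· * ·) (Fin.init a) := by
        funext i
        simp only [Fin.contractNth, Fin.init, Fin.val_castSucc]
        rfl
      have e2 : Fin.contractNth j.castSucc.castSucc (· * ·) a (Fin.last n) =
          a (Fin.last (n + 1)) := by
        rw [Fin.contractNth_apply_of_gt _ _ _ _ (by simp)]
        rfl
      rw [e1, e2]
    have h2 : (bar k A (n + 1)).act (barMk k A (n + 1) (Fin.init a)) (a (Fin.last (n + 1))) =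
        barMk k A (n + 1) (Fin.contractNth (Fin.last n).castSucc (· * ·) a) := by
      rw [barMk_act, barMk_succ]
      congr 2
      · congr 1
        funext i
        simp only [Fin.init]
        rw [Fin.contractNth_apply_of_lt _ _ _ _ (by simp)]
      · rw [Fin.contractNth_apply_of_eq _ _ _ _ (by simp)]
        rfl
    simp only [h0, h1, h2, Fin.val_castSucc, Fin.val_last]
    rw [smul_add ((-1 : k) ^ (n + 1)), smul_add ((-1 : k) ^ (n + 1)), smul_add ((-1 : k) ^ n),
      smul_smul ((-1 : k) ^ (n + 1)) ((-1 : k) ^ (n + 1)),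
      ← mul_pow, neg_one_mul, neg_neg, one_pow, one_smul]
    rw [show Fin.init a 0 = a 0 from rfl, pow_succ]
    module

/-- The Hochschild differential, up to a sign, on linear maps out of the bar modules, for the
left multiplication `l` and the right multiplication `r` on `M`. -/
def barD (l : A →ₗ[k] M →ₗ[k] M) (r : M →ₗ[k] A →ₗ[k] M) {n : ℕ} (g : bar k A n →ₗ[k] M) :
    bar k A (n + 1) →ₗ[k] M :=
  barLift r g - barE l n g

/-- The coboundaries for `barD`. -/
def IsBarDCoboundary (l : A →ₗ[k] M →ₗ[k] M) (r : M →ₗ[k] A →ₗ[k] M) :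
    (n : ℕ) → (bar k A n →ₗ[k] M) → Prop
  | 0, g => g = 0
  | n + 1, g => ∃ g' : bar k A n →ₗ[k] M, barD l r g' = g

theorem barD_smul (l : A →ₗ[k] M →ₗ[k] M) (r : M →ₗ[k] A →ₗ[k] M) {n : ℕ} (c : k)
    (g : bar k A n →ₗ[k] M) : barD l r (c • g) = c • barD l r g := by
  refine bar_ext fun p a => ?_
  simp [barD, smul_sub]

theorem barD_counit {l : A →ₗ[k] M →ₗ[k] M} (hl : ∀ a m, l a m = counit (R := k) a • m)
    (r : M →ₗ[k] A →ₗ[k] M) {n : ℕ} (g : bar k A n →ₗ[k] M) : barD l r g = barδ r g := by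
  rw [barD, barE_counit hl, barδ]

theorem isBarDCoboundary_counit {l : A →ₗ[k] M →ₗ[k] M}
    (hl : ∀ a m, l a m = counit (R := k) a • m) (r : M →ₗ[k] A →ₗ[k] M) (n : ℕ)
    (g : bar k A n →ₗ[k] M) : IsBarDCoboundary l r n g ↔ IsBarCoboundary r n g := by
  cases n with
  | zero => rfl
  | succ n => simp only [IsBarDCoboundary, IsBarCoboundary, barD_counit hl]

section Bimodule

variable [Module A M] [Module Aᵐᵒᵖ M] [IsScalarTower k A M] [IsScalarTower k Aᵐᵒᵖ M]
  {l : A →ₗ[k] M →ₗ[k] M} {r : M →ₗ[k] A →ₗ[k] M}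

theorem hochschild_d_barCochain (hl : ∀ a m, l a m = a • m)
    (hr : ∀ m a, r m a = MulOpposite.op a • m) (n : ℕ) (g : bar k A n →ₗ[k] M) :
    Hochschild.d k A M n (barCochain k A n M g) =
      (-1 : k) ^ (n + 1) • barCochain k A (n + 1) M (barD l r g) := by
  ext a
  have h1 : Hochschild.d k A M n (barCochain k A n M g) a =
      a 0 • g (barMk k A n (Fin.tail a)) + ∑ j : Fin n, (-1 : k) ^ ((j : ℕ) + 1) •
        g (barMk k A n (Fin.contractNth j.castSucc (· * ·) a)) +
      (-1 : k) ^ (n + 1) • MulOpposite.op (a (Fin.last n)) • g (barMk k A n (Fin.init a)) := by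
    simp only [← barCochain_apply]
    generalize barCochain k A n M g = f
    change (Hochschild.firstFace f + ∑ j : Fin n, (-1 : k) ^ ((j : ℕ) + 1) •
      Hochschild.innerFace j f + (-1 : k) ^ (n + 1) • Hochschild.lastFace f :
        Hochschild.Cochain k A M (n + 1)) a = _
    simp only [add_apply, smul_apply, sum_apply]
    rfl
  have h2 : barLift r g (barMk k A (n + 1) a) =
      MulOpposite.op (a (Fin.last n)) • g (barMk k A n (Fin.init a)) := by
    rw [barMk_succ, barLift_barTmul, hr]
  rw [h1, smul_apply, barCochain_apply, barD, LinearMap.sub_apply, barE_barMk, h2,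
    hl, smul_sub, smul_smul ((-1 : k) ^ (n + 1)) ((-1 : k) ^ n), pow_succ, mul_right_comm,
    ← mul_pow, neg_one_mul, neg_neg, one_pow, one_mul, neg_one_smul, sub_neg_eq_add, add_comm]

theorem barCochain_mem_coboundaries (hl : ∀ a m, l a m = a • m)
    (hr : ∀ m a, r m a = MulOpposite.op a • m) (n : ℕ) (g : bar k A n →ₗ[k] M) :
    barCochain k A n M g ∈ Hochschild.coboundaries k A M n ↔ IsBarDCoboundary l r n g := by
  cases n with
  | zero =>
    change barCochain k A 0 M g ∈ (⊥ : Submodule k _) ↔ g = 0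
    rw [Submodule.mem_bot, LinearEquiv.map_eq_zero_iff]
  | succ n =>
    have hs : (-1 : k) ^ (n + 1) * (-1 : k) ^ (n + 1) = 1 := by
      rw [← mul_pow, neg_one_mul, neg_neg, one_pow]
    change barCochain k A (n + 1) M g ∈ LinearMap.range (Hochschild.d k A M n) ↔
      ∃ g' : bar k A n →ₗ[k] M, barD l r g' = g
    constructor
    · rintro ⟨f, hf⟩
      obtain ⟨g', rfl⟩ := (barCochain k A n M).surjective f
      refine ⟨(-1 : k) ^ (n + 1) • g', (barCochain k A (n + 1) M).injective ?_⟩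
      rw [← hf, hochschild_d_barCochain hl hr, barD_smul, map_smul]
    · rintro ⟨g', rfl⟩
      refine ⟨(-1 : k) ^ (n + 1) • barCochain k A n M g', ?_⟩
      rw [map_smul, hochschild_d_barCochain hl hr, smul_smul, hs, one_smul]

theorem nontrivial_hochschildCohomology_iff (hl : ∀ a m, l a m = a • m)
    (hr : ∀ m a, r m a = MulOpposite.op a • m) (n : ℕ) :
    Nontrivial (Hochschild.Cohomology k A M n) ↔
      ∃ g : bar k A n →ₗ[k] M, barD l r g = 0 ∧ ¬ IsBarDCoboundary l r n g := by
  have hz (g : bar k A n →ₗ[k] M) :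
      barCochain k A n M g ∈ LinearMap.ker (Hochschild.d k A M n) ↔ barD l r g = 0 := by
    rw [LinearMap.mem_ker, hochschild_d_barCochain hl hr,
      smul_eq_zero_iff_right (pow_ne_zero _ (neg_ne_zero.2 one_ne_zero)),
      LinearEquiv.map_eq_zero_iff]
  rw [Submodule.Quotient.nontrivial_iff, ne_eq, Submodule.submoduleOf_eq_top,
    SetLike.not_le_iff_exists]
  constructor
  · rintro ⟨f, hf, hf'⟩
    obtain ⟨g, rfl⟩ := (barCochain k A n M).surjective f
    exact ⟨g, (hz g).1 hf, fun h => hf' ((barCochain_mem_coboundaries hl hr n g).2 h)⟩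
  · rintro ⟨g, hg, hg'⟩
    exact ⟨barCochain k A n M g, (hz g).2 hg,
      fun h => hg' ((barCochain_mem_coboundaries hl hr n g).1 h)⟩

end Bimodule

end Hochschild

end YetterDrinfeld

/-! ## The adjoint action and the comparison of coefficients -/

section Twist

variable {k A M : Type u} [Field k] [Ring A] [HopfAlgebra k A] [AddCommGroup M] [Module k M]

/-- The map `u ↦ (a ↦ f(a₁) u(a₂))` on linear maps `A → M`. -/
def twist (l : A →ₗ[k] M →ₗ[k] M) (f : A →ₗ[k] A) : (A →ₗ[k] M) →ₗ[k] (A →ₗ[k] M) :=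
  LinearMap.lcomp k M (comul (R := k)) ∘ₗ
    LinearMap.llcomp k (A ⊗[k] A) (A ⊗[k] M) M (TensorProduct.lift (l ∘ₗ f)) ∘ₗ
    LinearMap.lTensorHom A

theorem twist_apply (l : A →ₗ[k] M →ₗ[k] M) (f : A →ₗ[k] A) (u : A →ₗ[k] M) (a : A) :
    twist l f u a = TensorProduct.lift (l ∘ₗ f) (u.lTensor A (comul (R := k) a)) := rfl

theorem twist_comp {l : A →ₗ[k] M →ₗ[k] M} (f : A →ₗ[k] A) (φ : M →ₗ[k] M)
    (hφ : ∀ a m, φ (l a m) = l a (φ m)) (u : A →ₗ[k] M) :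
    twist l f (φ ∘ₗ u) = φ ∘ₗ twist l f u := by
  ext a
  rw [LinearMap.comp_apply, twist_apply, twist_apply]
  induction comul (R := k) a with
  | zero => simp
  | add s t hs ht => simp only [map_add, hs, ht]
  | tmul x y => simp [hφ]

/-- Twists compose by convolution: both sides are `f(a₁)g(a₂)u(a₃)`. Hence `twist l S` and `twist l
id` are mutually inverse. -/
theorem twist_twist {l : A →ₗ[k] M →ₗ[k] M} (hl : ∀ a b m, l (a * b) m = l a (l b m))
    (f g : A →ₗ[k] A) (u : A →ₗ[k] M) :
    twist l f (twist l g u) =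
      twist l (LinearMap.mul' k A ∘ₗ TensorProduct.map f g ∘ₗ comul (R := k)) u := by
  ext a
  have h (s : A ⊗[k] (A ⊗[k] A)) :
      TensorProduct.lift (l ∘ₗ f)
        (((TensorProduct.lift (l ∘ₗ g)) ∘ₗ u.lTensor A).lTensor A s) =
      TensorProduct.lift (l ∘ₗ LinearMap.mul' k A ∘ₗ TensorProduct.map f g)
        (u.lTensor (A ⊗[k] A) ((TensorProduct.assoc k A A A).symm s)) := by
    induction s with
    | zero => simp
    | add s t hs ht => simp only [map_add, hs, ht]
    | tmul x s =>
      induction s with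
      | zero => simp
      | add s t hs ht => simp only [tmul_add, map_add, hs, ht]
      | tmul y z => simp [hl]
  have h' (s : A ⊗[k] A) :
      TensorProduct.lift (l ∘ₗ LinearMap.mul' k A ∘ₗ TensorProduct.map f g)
        (u.lTensor (A ⊗[k] A) ((comul (R := k)).rTensor A s)) =
      TensorProduct.lift (l ∘ₗ LinearMap.mul' k A ∘ₗ TensorProduct.map f g ∘ₗ comul (R := k))
        (u.lTensor A s) := by
    induction s with
    | zero => simp
    | add s t hs ht => simp only [map_add, hs, ht]
    | tmul x y => simp
  have e : twist l g u = (TensorProduct.lift (l ∘ₗ g) ∘ₗ u.lTensor A) ∘ₗ comul (R := k) := rfl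
  rw [twist_apply, e, LinearMap.lTensor_comp_apply, h, ← Coalgebra.coassoc_apply,
    LinearEquiv.symm_apply_apply, h']
  rfl

theorem twist_unit {l : A →ₗ[k] M →ₗ[k] M} (hl : ∀ m, l 1 m = m) (u : A →ₗ[k] M) :
    twist l (Algebra.linearMap k A ∘ₗ counit (R := k)) u = u := by
  ext a
  have h (s : A ⊗[k] A) :
      TensorProduct.lift (l ∘ₗ Algebra.linearMap k A ∘ₗ counit (R := k)) (u.lTensor A s) =
      u (TensorProduct.lid k A ((counit (R := k)).rTensor A s)) := by
    induction s with
    | zero => simp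
    | add s t hs ht => simp only [map_add, hs, ht]
    | tmul x y => simp [Algebra.algebraMap_eq_smul_one, hl]
  rw [twist_apply, h]
  simp

theorem twist_antipode_left {l : A →ₗ[k] M →ₗ[k] M} (hl : ∀ m, l 1 m = m)
    (hl' : ∀ a b m, l (a * b) m = l a (l b m)) (u : A →ₗ[k] M) :
    twist l (antipode k) (twist l LinearMap.id u) = u := by
  rw [twist_twist hl']
  exact (congrArg (fun f => twist l f u) (HopfAlgebra.mul_antipode_rTensor_comul)).trans
    (twist_unit hl u)

theorem twist_antipode_right {l : A →ₗ[k] M →ₗ[k] M} (hl : ∀ m, l 1 m = m)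
    (hl' : ∀ a b m, l (a * b) m = l a (l b m)) (u : A →ₗ[k] M) :
    twist l LinearMap.id (twist l (antipode k) u) = u := by
  rw [twist_twist hl']
  exact (congrArg (fun f => twist l f u) (HopfAlgebra.mul_antipode_lTensor_comul)).trans
    (twist_unit hl u)

/-- The automorphism `u ↦ (a ↦ S(a₁) u(a₂))`. -/
def twistEquiv {l : A →ₗ[k] M →ₗ[k] M} (hl : ∀ m, l 1 m = m)
    (hl' : ∀ a b m, l (a * b) m = l a (l b m)) : (A →ₗ[k] M) ≃ₗ[k] (A →ₗ[k] M) :=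
  LinearEquiv.ofLinearMap (twist l (antipode k)) (twist l LinearMap.id)
    (LinearMap.ext (twist_antipode_left hl hl')) (LinearMap.ext (twist_antipode_right hl hl'))

/-- The adjoint action `m ◁ a = S(a₁) m a₂`. -/
def adjointAct (l : A →ₗ[k] M →ₗ[k] M) (r : M →ₗ[k] A →ₗ[k] M) : M →ₗ[k] A →ₗ[k] M :=
  twist l (antipode k) ∘ₗ r

theorem isRightAction_adjointAct {l : A →ₗ[k] M →ₗ[k] M} {r : M →ₗ[k] A →ₗ[k] M}
    (hl : ∀ m, l 1 m = m) (hl' : ∀ a b m, l (a * b) m = l a (l b m)) (hr : IsRightAction r)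
    (hlr : ∀ a m b, r (l a m) b = l a (r m b)) : IsRightAction (adjointAct l r) where
  act_one m := by
    change twist l (antipode k) (r m) 1 = m
    rw [twist_apply, Bialgebra.comul_one, Algebra.TensorProduct.one_def, LinearMap.lTensor_tmul,
      TensorProduct.lift.tmul, LinearMap.comp_apply, HopfAlgebra.antipode_one, hl, hr.act_one]
  act_mul m a b := by
    have h (m : M) (s t : A ⊗[k] A) :
        TensorProduct.lift (l ∘ₗ antipode k) ((r m).lTensor A (s * t)) =
        TensorProduct.lift (l ∘ₗ antipode k) ((r (TensorProduct.lift (l ∘ₗ antipode k)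
          ((r m).lTensor A s))).lTensor A t) := by
      induction t with
      | zero => simp
      | add t t' h h' => simp only [mul_add, map_add, h, h']
      | tmul y y' =>
        induction s with
        | zero => simp
        | add t t' h h' =>
          simp only [add_mul, map_add, h, h', LinearMap.lTensor_add, LinearMap.add_apply]
        | tmul x x' =>
          simp [HopfAlgebra.antipode_mul_antidistrib, hl', hlr, hr.act_mul]
    change twist l (antipode k) (r m) (a * b) =
      twist l (antipode k) (r (twist l (antipode k) (r m) a)) b
    simp only [twist_apply, Bialgebra.comul_mul, h]

/-- In Sweedler notation, `S(a₁)S(b₁) w(b₂a₂) = S(b₁a₁) w(b₂a₂)`. This makes `barTwist` compatible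
with multiplying neighbouring entries. -/
theorem twist_antipode_mul {l : A →ₗ[k] M →ₗ[k] M} (hl' : ∀ a b m, l (a * b) m = l a (l b m))
    (w : A →ₗ[k] M) (a b : A) :
    twist l (antipode k)
      ((twist l (antipode k) ∘ₗ ((LinearMap.mul k A).compr₂ w).flip).flip b) a =
      twist l (antipode k) w (b * a) := by
  have h (s t : A ⊗[k] A) :
      TensorProduct.lift (l ∘ₗ antipode k) ((((TensorProduct.lift (l ∘ₗ antipode k)) ∘ₗ
        (LinearMap.lTensorHom A ∘ₗ ((LinearMap.mul k A).compr₂ w).flip).flip s)).lTensor A t) =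
      TensorProduct.lift (l ∘ₗ antipode k) (w.lTensor A (s * t)) := by
    induction t with
    | zero => simp
    | add t t' h h' => simp only [mul_add, map_add, h, h']
    | tmul y y' =>
      induction s with
      | zero => simp
      | add t t' h h' =>
        simp only [add_mul, map_add, LinearMap.comp_add, LinearMap.lTensor_add,
          LinearMap.add_apply, h, h']
      | tmul x x' => simp [HopfAlgebra.antipode_mul_antidistrib, hl']
  rw [twist_apply l _ w, Bialgebra.comul_mul, ← h]
  rfl

end Twist

/-! ### The isomorphism from the Hochschild complex to the standard complex of the adjoint module.
-/

namespace YetterDrinfeld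

section BarTwist

variable {k A M : Type u} [Field k] [Ring A] [HopfAlgebra k A] [AddCommGroup M] [Module k M]
  {l : A →ₗ[k] M →ₗ[k] M} {r : M →ₗ[k] A →ₗ[k] M}

/-- The isomorphism `Φ` with `Φ(g)(p ⊗ a) = S(a₁) Φ(g(- ⊗ a₂))(p)`. -/
def barTwist (hl : ∀ m, l 1 m = m) (hl' : ∀ a b m, l (a * b) m = l a (l b m)) :
    (n : ℕ) → ((bar k A n →ₗ[k] M) ≃ₗ[k] (bar k A n →ₗ[k] M))
  | 0 => LinearEquiv.refl k _
  | n + 1 => barSlice.trans ((LinearEquiv.congrRight (barTwist hl hl' n)).trans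
      (LinearMap.lflip.trans ((LinearEquiv.congrRight (twistEquiv hl hl')).trans
        (barCurry k A M n))))

variable (hl : ∀ m, l 1 m = m) (hl' : ∀ a b m, l (a * b) m = l a (l b m))

theorem barTwist_succ_barTmul (n : ℕ) (g : bar k A (n + 1) →ₗ[k] M) (p : bar k A n) (a : A) :
    barTwist hl hl' (n + 1) g (barTmul k A n p a) =
      twist l (antipode k) (((barTwist hl hl' n).toLinearMap ∘ₗ barSlice g).flip p) a := rfl

theorem barTwist_comp (φ : M →ₗ[k] M) (hφ : ∀ a m, φ (l a m) = l a (φ m)) (n : ℕ)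
    (g : bar k A n →ₗ[k] M) : barTwist hl hl' n (φ ∘ₗ g) = φ ∘ₗ barTwist hl hl' n g := by
  induction n with
  | zero => rfl
  | succ n ih =>
    refine bar_ext fun p a => ?_
    change _ = φ (barTwist hl hl' (n + 1) g (barTmul k A n p a))
    rw [barTwist_succ_barTmul, barTwist_succ_barTmul, ← LinearMap.comp_apply (f := φ),
      ← twist_comp _ φ hφ]
    congr 2
    ext c
    exact LinearMap.congr_fun (ih (barSlice g c)) p

/-- Right multiplication commutes with left multiplication and so passes through `Φ`; the antipode
attached to the last factor turns it into `S(a₁)(-)a₂`. -/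
theorem barTwist_barLift (hlr : ∀ a m b, r (l a m) b = l a (r m b)) (n : ℕ)
    (g : bar k A n →ₗ[k] M) :
    barTwist hl hl' (n + 1) (barLift r g) = barLift (adjointAct l r) (barTwist hl hl' n g) := by
  refine bar_ext fun p a => ?_
  rw [barTwist_succ_barTmul]
  change _ = twist l (antipode k) (r (barTwist hl hl' n g p)) a
  congr 2
  ext c
  exact LinearMap.congr_fun (barTwist_comp hl hl' (r.flip c) (fun a m => hlr a m c) n g) p

/-- That is, `S(a₁) Φ(g(- ← a₂))(t) = Φ(g)(t ← a)`: the face multiplying `a` into the last entry of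
`t` is respected by `Φ`. -/
theorem barTwist_act (n : ℕ) (g : bar k A (n + 1) →ₗ[k] M) (t : bar k A (n + 1)) (a : A) :
    twist l (antipode k) (((barTwist hl hl' (n + 1)).toLinearMap ∘ₗ
      ((bar k A (n + 1)).act.compr₂ g).flip).flip t) a =
      barTwist hl hl' (n + 1) g ((bar k A (n + 1)).act t a) := by
  refine LinearMap.congr_fun (f := (twist l (antipode k) ∘ₗ
    ((barTwist hl hl' (n + 1)).toLinearMap ∘ₗ
      ((bar k A (n + 1)).act.compr₂ g).flip).flip).flip a)
    (g := barTwist hl hl' (n + 1) g ∘ₗ (bar k A (n + 1)).act.flip a) (bar_ext fun p b => ?_) t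
  change _ = barTwist hl hl' (n + 1) g ((bar k A (n + 1)).act (barTmul k A n p b) a)
  rw [bar_act_barTmul, barTwist_succ_barTmul, ← twist_antipode_mul hl']
  change twist l (antipode k) _ a = _
  congr 2

/-- In degree `0`, `S(a₁)a₂ g(p) = ε(a) g(p)`, so the left action becomes trivial. The induction
step handles the inner face by `barTwist_act`, leaving the recursion of `bard`. -/
theorem barTwist_barE (n : ℕ) (g : bar k A n →ₗ[k] M) :
    barTwist hl hl' (n + 1) (barE l n g) = barTwist hl hl' n g ∘ₗ Hom.lin (bard k A n) := by
  induction n with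
  | zero =>
    refine bar_ext fun p a => ?_
    change twist l (antipode k) (l.flip (g p)) a = g (Hom.lin (bard k A 0) (barTmul k A 0 p a))
    have e : l.flip (g p) = twist l LinearMap.id
        (LinearMap.toSpanSingleton k M (g p) ∘ₗ counit (R := k)) := by
      ext a
      have h (s : A ⊗[k] A) : TensorProduct.lift (l ∘ₗ LinearMap.id)
          ((LinearMap.toSpanSingleton k M (g p) ∘ₗ counit (R := k)).lTensor A s) =
          l (TensorProduct.rid k A ((counit (R := k)).lTensor A s)) (g p) := by
        induction s with
        | zero => simp
        | add s t hs ht => simp only [map_add, LinearMap.add_apply, hs, ht]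
        | tmul x y => simp
      rw [twist_apply, h]
      simp
    rw [e, twist_antipode_left hl hl', bard_zero_barTmul, LinearMap.comp_apply,
      LinearMap.toSpanSingleton_apply, ← map_smul]
    congr 1
    exact mul_comm (counit (R := k) a) (show k from p)
  | succ n ih =>
    refine bar_ext fun p a => ?_
    rw [barTwist_succ_barTmul]
    change _ = barTwist hl hl' (n + 1) g (Hom.lin (bard k A (n + 1)) (barTmul k A (n + 1) p a))
    rw [bard_succ_barTmul, map_sub, ← barTwist_act, barTwist_succ_barTmul,
      ← LinearMap.sub_apply, ← map_sub]
    congr 2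
    ext c
    have e : barSlice (barE l (n + 1) g) c =
        ((bar k A (n + 1)).act.compr₂ g).flip c - barE l n (barSlice g c) := rfl
    change barTwist hl hl' (n + 1) (barSlice (barE l (n + 1) g) c) p = _
    rw [e, map_sub, ih]
    rfl

theorem barTwist_barD (hlr : ∀ a m b, r (l a m) b = l a (r m b)) (n : ℕ)
    (g : bar k A n →ₗ[k] M) :
    barTwist hl hl' (n + 1) (barD l r g) = barδ (adjointAct l r) (barTwist hl hl' n g) := by
  rw [barD, map_sub, barTwist_barLift hl hl' hlr, barTwist_barE, barδ]

theorem isBarCoboundary_barTwist (hlr : ∀ a m b, r (l a m) b = l a (r m b)) (n : ℕ)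
    (g : bar k A n →ₗ[k] M) (h : IsBarCoboundary (adjointAct l r) n (barTwist hl hl' n g)) :
    IsBarDCoboundary l r n g := by
  cases n with
  | zero => exact h
  | succ n =>
    obtain ⟨g', hg'⟩ := h
    obtain ⟨g', rfl⟩ := (barTwist hl hl' n).surjective g'
    exact ⟨g', (barTwist hl hl' (n + 1)).injective ((barTwist_barD hl hl' hlr n g').trans hg')⟩

end BarTwist

/-! ### Transfer of nonvanishing in both directions. -/

section Main

variable {k A : Type u} [Field k] [Ring A] [HopfAlgebra k A]

theorem exists_nontrivial_gsCohomology (hA : IsCosemisimple k A) {M : Type u} [AddCommGroup M]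
    [Module k M] [Module A M] [Module Aᵐᵒᵖ M] [SMulCommClass A Aᵐᵒᵖ M] [IsScalarTower k A M]
    [IsScalarTower k Aᵐᵒᵖ M] (n : ℕ) (hM : Nontrivial (Hochschild.Cohomology k A M n)) :
    ∃ V : YetterDrinfeld k A, Nontrivial (GSCohomology k A V n) := by
  let l : A →ₗ[k] M →ₗ[k] M := (Algebra.lsmul k k M : A →ₐ[k] Module.End k M).toLinearMap
  let r : M →ₗ[k] A →ₗ[k] M :=
    ((Algebra.lsmul k k M : Aᵐᵒᵖ →ₐ[k] Module.End k M).toLinearMap ∘ₗ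
      (MulOpposite.opLinearEquiv k : A ≃ₗ[k] Aᵐᵒᵖ).toLinearMap).flip
  have hl : ∀ m, l 1 m = m := fun m => one_smul A m
  have hl' : ∀ a b m, l (a * b) m = l a (l b m) := fun a b m => mul_smul a b m
  have hr : IsRightAction r := ⟨fun m => one_smul Aᵐᵒᵖ m,
    fun m a b => mul_smul (MulOpposite.op b) (MulOpposite.op a) m⟩
  have hlr : ∀ a m b, r (l a m) b = l a (r m b) :=
    fun a m b => (smul_comm a (MulOpposite.op b) m).symm
  obtain ⟨g, hg, hg'⟩ := (nontrivial_hochschildCohomology_iff (l := l) (r := r) (fun _ _ => rfl)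
    (fun _ _ => rfl) n).1 hM
  -- The coefficient module is the cofree module on `M` with the adjoint action.
  refine ⟨_, nontrivial_gsCohomology_cofree hA (isRightAction_adjointAct hl hl' hr hlr) n
    (barTwist hl hl' n g) ?_ fun h => hg' (isBarCoboundary_barTwist hl hl' hlr n g h)⟩
  rw [← barTwist_barD hl hl' hlr, hg, map_zero]

theorem exists_nontrivial_hochschildCohomology (hA : IsCosemisimple k A) (hS : IsKacType k A)
    (V : YetterDrinfeld k A) (n : ℕ) (hV : Nontrivial (GSCohomology k A V n)) :
    ∃ (M : Type u) (_ : AddCommGroup M) (_ : Module k M) (_ : Module A M) (_ : Module Aᵐᵒᵖ M)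
      (_ : SMulCommClass A Aᵐᵒᵖ M) (_ : IsScalarTower k A M) (_ : IsScalarTower k Aᵐᵒᵖ M),
      Nontrivial (Hochschild.Cohomology k A M n) := by
  obtain ⟨g, hg, hg'⟩ := exists_barδ_of_nontrivial_gsCohomology hA hS V n hV
  -- The bimodule is `V` with its own right action and left action through `ε`, so that `barD`
  -- reduces to `barδ`.
  let _ : Module A V := Module.compHom V (Bialgebra.counitAlgHom k A).toRingHom
  let _ : Module Aᵐᵒᵖ V :=
    { smul := fun a v => V.act v a.unop
      one_smul := V.isYD.act_one
      mul_smul := fun a b v => V.isYD.act_mul v b.unop a.unop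
      smul_zero := fun a => by
        change V.act 0 a.unop = 0
        simp
      smul_add := fun a v w => by
        change V.act (v + w) a.unop = V.act v a.unop + V.act w a.unop
        simp
      add_smul := fun a b v => map_add (V.act v) a.unop b.unop
      zero_smul := fun v => map_zero (V.act v) }
  have h1 (a : A) (v : V) : a • v = counit (R := k) a • v := rfl
  have h2 (a : Aᵐᵒᵖ) (v : V) : a • v = V.act v a.unop := rfl
  have : SMulCommClass A Aᵐᵒᵖ V := ⟨fun a b v => by simp [h1, h2]⟩
  have : IsScalarTower k A V := ⟨fun c a v => by simp [h1, mul_smul]⟩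
  have : IsScalarTower k Aᵐᵒᵖ V := ⟨fun c a v => by simp [h2]⟩
  let l : A →ₗ[k] V →ₗ[k] V := (LinearMap.lsmul k V) ∘ₗ counit (R := k)
  have hl : ∀ a v, l a v = counit (R := k) a • v := fun _ _ => rfl
  refine ⟨V, inferInstance, inferInstance, inferInstance, inferInstance, inferInstance,
    inferInstance, inferInstance,
    (nontrivial_hochschildCohomology_iff (l := l) (r := V.act) (fun _ _ => rfl)
      (fun _ _ => rfl) n).2 ⟨g, ?_, ?_⟩⟩
  · rw [barD_counit hl, hg]
  · rwa [isBarDCoboundary_counit hl]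

end Main

end YetterDrinfeld

end

theorem mainTheorem4 {k A : Type u} [Field k] [Ring A] [HopfAlgebra k A]
    (hA : IsCosemisimple k A) (hS : IsKacType k A) :
    hochschildCohomDim k A = gsCohomDim k A := by
  unfold hochschildCohomDim gsCohomDim
  -- The two sets of degrees coincide, which is stronger than equality of their suprema.
  congr 1
  ext N
  refine exists_congr fun n => and_congr_right fun _ => ⟨?_, ?_⟩
  · rintro ⟨M, _, _, _, _, _, _, _, hM⟩
    exact YetterDrinfeld.exists_nontrivial_gsCohomology hA n hM
  · rintro ⟨V, hV⟩
    exact YetterDrinfeld.exists_nontrivial_hochschildCohomology hA hS V n hV
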